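/- Let $\mathcal H,\mathcal K$ be separable infinite-dimensional complex Hilbert spaces. Let $\mathcal N_0$ be a multiplicity-free continuous nest on $\mathcal H$, that is, a linearly ordered, weakly closed set of projections containing $0$ and $I$, having no minimal intervals $N-M$ ($M<N$ in $\mathcal N_0$), and such that $\mathcal N_0''$ has a cyclic and separating vector. Index it compatibly with its spectral measure as $\mathcal N_0=\{N^0_t: t\in[0,1]\}$; i.e. for some unitary $U:\mathcal H\to L^2([0,1])$ (Lebesgue measure), $UN^0_tU^*$ is multiplication by the characteristic function of $[0,t]$ for every $t$. Let $\mathcal D_0$ be an atomic masa (maximal abelian self-adjoint algebra) on $\mathcal K$, and $(\epsilon_i)_{i\in\mathbb N}$ an orthonormal basis of $\mathcal K$ consisting of vectors in the (one-dimensional) atoms of $\mathcal D_0$. On $\mathcal H\otimes\mathcal K$ put $N_t:=N^0_t\otimes I$ (with $N_t:=0$ for $t<0$ and $N_t:=I$ for $t>1$), $\mathcal N:=\{N_t\}=\mathcal N_0\otimes I$, $E_i:=I\otimes\langle\,\cdot\,,\epsilon_i\rangle\epsilon_i$ and $M_k^\perp:=I-\sum_{i\le k}E_i$, and let $\operatorname{Alg}\mathcal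 N$ be the algebra of bounded operators leaving invariant the range of every $N\in\mathcal N$. For $X\in\operatorname{Alg}\mathcal N$, $t\in[0,1]$ and $i,j\in\mathbb N$ define $$i_t(X):=\inf\{\|(N_b-N_a)X(N_b-N_a)\| : a<t<b\},$$ $$r_{i,t}(X):=\lim_{k\to\infty}i_t(E_iXM_k^\perp),\qquad c_{j,t}(X):=\lim_{k\to\infty}i_t(M_k^\perp XE_j).$$ Let $(\mathbf S,\mathbf R,\mathbf C)$ be an extended triangular system: families of Borel subsets $S_{i,j},R_i,C_j$ ($i,j\in\mathbb N$) of $[0,1]$ such that, for all $i,j,k\in\mathbb N$, $S_{i,i}=[0,1]$; $S_{i,j}\cap S_{j,i}=\emptyset$ if $i\ne j$; $S_{i,j}\cap S_{j,k}\subseteq S_{i,k}$; $C_i\cap S_{i,j}\subseteq C_j$; $S_{i,j}\cap R_j\subseteq R_i$; and $R_i\cap C_j\subseteq S_{i,j}$. Let $\mathcal T(\mathbf S,\mathbf R,\mathbf C)$ be the set of all $X\in\operatorname{Alg}\mathcal N$ such that, for all $i,j\in\mathbb N$, $i_t(E_iXE_j)=0$ for a.e. $t\in[0,1]\setminus S_{i,j}$,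 $r_{i,t}(X)=0$ for a.e. $t\in[0,1]\setminus R_i$, and $c_{j,t}(X)=0$ for a.e. $t\in[0,1]\setminus C_j$ (Lebesgue measure). Then $\mathcal T=\mathcal T(\mathbf S,\mathbf R,\mathbf C)$ is a triangular algebra: it is a subalgebra of $B(\mathcal H\otimes\mathcal K)$ and its diagonal $\mathcal T\cap\mathcal T^*$ is a masa in $B(\mathcal H\otimes\mathcal K)$. Moreover $\mathcal T\cap\mathcal T^*=\mathcal N_0'\otimes\mathcal D_0$, the von Neumann algebra generated by the operators $A\otimes B$ with $A\in\mathcal N_0'$ and $B\in\mathcal D_0$. -/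

import Mathlib

open MeasureTheory Filter Topology
open scoped TensorProduct InnerProductSpace

noncomputable section

namespace TriangularAlgebras

/-! ### Masas and triangular algebras -/

section Triangular

variable {L : Type*} [NormedAddCommGroup L] [InnerProductSpace ℂ L] [CompleteSpace L]

/-- A maximal abelian self-adjoint algebra of bounded operators: a `*`-subalgebra of `B(L)` which is
maximal among the commutative ones. -/
def IsMasa (D : StarSubalgebra ℂ (L →L[ℂ] L)) : Prop :=
  Maximal (fun B : StarSubalgebra ℂ (L →L[ℂ] L) => ∀ x ∈ B, ∀ y ∈ B, x * y = y * x) D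

/-- The diagonal `T ∩ T*` of an algebra `T` of bounded operators. -/
def diagonal (T : Subalgebra ℂ (L →L[ℂ] L)) : StarSubalgebra ℂ (L →L[ℂ] L) where
  carrier := {X | X ∈ T ∧ star X ∈ T}
  mul_mem' := fun {a b} ha hb => ⟨T.mul_mem ha.1 hb.1, by
    rw [star_mul]; exact T.mul_mem hb.2 ha.2⟩
  add_mem' := fun {a b} ha hb => ⟨T.add_mem ha.1 hb.1, by
    rw [star_add]; exact T.add_mem ha.2 hb.2⟩
  algebraMap_mem' := fun r => ⟨T.algebraMap_mem r, by
    rw [← algebraMap_star_comm]; exact T.algebraMap_mem _⟩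
  star_mem' := fun {a} ha => ⟨ha.2, by rw [star_star]; exact ha.1⟩

/-- A set of bounded operators is a triangular algebra if it is a subalgebra of `B(L)` whose
diagonal is a masa in `B(L)`. -/
def IsTriangularAlgebra (T : Set (L →L[ℂ] L)) : Prop :=
  ∃ A : Subalgebra ℂ (L →L[ℂ] L), (A : Set (L →L[ℂ] L)) = T ∧ IsMasa (diagonal A)

/-- The atoms of a `*`-algebra of operators: its minimal nonzero projections. -/
def IsAtomOf (D : StarSubalgebra ℂ (L →L[ℂ] L)) (P : L →L[ℂ] L) : Prop :=
  Minimal (fun Q : L →L[ℂ] L => Q ∈ D ∧ IsStarProjection Q ∧ Q ≠ 0) P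

/-- An atomic masa: a masa for which the ranges of the atoms span a dense subspace. -/
structure IsAtomicMasa (D : StarSubalgebra ℂ (L →L[ℂ] L)) : Prop where
  isMasa : IsMasa D
  dense_atoms :
    Dense (Submodule.span ℂ {x : L | ∃ P, IsAtomOf D P ∧ P x = x} : Set L)

end Triangular

/-! ### Nests -/

section Nests

variable {L : Type*} [NormedAddCommGroup L] [InnerProductSpace ℂ L] [CompleteSpace L]

/-- A nest: a linearly ordered, weakly closed set of projections containing `0` and `I`. -/
structure IsNest (𝒩 : Set (L →L[ℂ] L)) : Prop where
  isStarProjection : ∀ P ∈ 𝒩, IsStarProjection P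
  isChain : IsChain (· ≤ ·) 𝒩
  zero_mem : 0 ∈ 𝒩
  one_mem : 1 ∈ 𝒩
  isClosed : IsClosed {A : L →WOT[ℂ] L | A.toCLM ∈ 𝒩}

/-- An interval of a nest: the difference of two of its projections `M < N`. -/
def IsNestInterval (𝒩 : Set (L →L[ℂ] L)) (F : L →L[ℂ] L) : Prop :=
  ∃ M ∈ 𝒩, ∃ N ∈ 𝒩, M < N ∧ F = N - M

/-- A nest is continuous if it has no atoms, i.e. no minimal intervals. -/
def IsContinuousNest (𝒩 : Set (L →L[ℂ] L)) : Prop :=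
  ∀ F, ¬ Minimal (IsNestInterval 𝒩) F

/-- A nest is multiplicity free if the von Neumann algebra `𝒩''` it generates has a cyclic and
separating vector. -/
def IsMultiplicityFree (𝒩 : Set (L →L[ℂ] L)) : Prop :=
  ∃ ξ : L, Dense {x : L | ∃ A ∈ Set.centralizer (Set.centralizer 𝒩), A ξ = x} ∧
    ∀ A ∈ Set.centralizer (Set.centralizer 𝒩), A ξ = 0 → A = 0

/-- The indexing `t ↦ N t` of the multiplicity-free continuous nest `𝒩` is compatible with the
spectral measure: under some unitary `U` onto `L²[0,1]` (Lebesgue measure), `N t` is multiplication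
by the characteristic function of `[0,t]`, and `𝒩 = {N t : t ∈ [0,1]}`. For convenience `t` ranges
over `ℝ`; the formula forces `N t = 0` for `t < 0` and `N t = I` for `t > 1`. -/
def IsSpectralIndexing (𝒩 : Set (L →L[ℂ] L)) (N : ℝ → L →L[ℂ] L) : Prop :=
  (∃ U : L ≃ₗᵢ[ℂ] Lp ℂ 2 (volume.restrict (Set.Icc (0 : ℝ) 1)),
    ∀ (t : ℝ) (f : L),
      (U (N t f) : ℝ → ℂ) =ᵐ[volume.restrict (Set.Icc (0 : ℝ) 1)]
        (Set.Icc (0 : ℝ) t).indicator (U f : ℝ → ℂ)) ∧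
  𝒩 = N '' Set.Icc (0 : ℝ) 1

/-- The nest algebra: the bounded operators leaving invariant the ranges of the projections
in `𝒩`. -/
def nestAlg (𝒩 : Set (L →L[ℂ] L)) : Set (L →L[ℂ] L) :=
  {X | ∀ P ∈ 𝒩, ∀ v : L, P v = v → P (X v) = X v}

/-- The diagonal seminorm function
`i_x(X) = inf {‖(N_t - N_s) X (N_t - N_s)‖ : s < x < t}`. -/
def diagSeminorm (N : ℝ → L →L[ℂ] L) (x : ℝ) (X : L →L[ℂ] L) : ℝ :=
  sInf {c : ℝ | ∃ s t : ℝ, s < x ∧ x < t ∧ c = ‖(N t - N s) * X * (N t - N s)‖}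

end Nests

/-! ### Hilbert space tensor products -/

section Tensor

variable (H K : Type*) [NormedAddCommGroup H] [InnerProductSpace ℂ H]
  [NormedAddCommGroup K] [InnerProductSpace ℂ K]

/-- The Hilbert space tensor product: the completion of the algebraic tensor product. -/
abbrev HilbertTensor : Type _ := UniformSpace.Completion (H ⊗[ℂ] K)

variable {H K}

/-- The bounded operator `A ⊗ B` on the Hilbert space tensor product. -/
def tensorOp (A : H →L[ℂ] H) (B : K →L[ℂ] K) :
    HilbertTensor H K →L[ℂ] HilbertTensor H K :=
  (TensorProduct.mapL A B).completion

/-- The von Neumann algebra tensor product: the von Neumann algebra (double commutant) generated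
by the operators `A ⊗ B` with `A ∈ 𝒜` and `B ∈ ℬ`. -/
def vnTensor (𝒜 : Set (H →L[ℂ] H)) (ℬ : Set (K →L[ℂ] K)) :
    Set (HilbertTensor H K →L[ℂ] HilbertTensor H K) :=
  Set.centralizer (Set.centralizer (Set.image2 tensorOp 𝒜 ℬ))

/-- The nest `𝒩₀ ⊗ I`. -/
def ampNest (𝒩₀ : Set (H →L[ℂ] H)) : Set (HilbertTensor H K →L[ℂ] HilbertTensor H K) :=
  (fun P => tensorOp P 1) '' 𝒩₀

/-- The indexed nest projections `N_t = N₀_t ⊗ I`. -/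
def ampIndex (N₀ : ℝ → H →L[ℂ] H) (t : ℝ) : HilbertTensor H K →L[ℂ] HilbertTensor H K :=
  tensorOp (N₀ t) 1

/-- `E_i = I ⊗ (ε_i ⊗ ε_i^*)`. -/
def blockProj (ε : HilbertBasis ℕ ℂ K) (i : ℕ) : HilbertTensor H K →L[ℂ] HilbertTensor H K :=
  tensorOp 1 (InnerProductSpace.rankOne ℂ (ε i) (ε i))

/-- `M_k^⊥`, where `M_k` is the sum of the first `k` of the projections `E_i`. -/
def tailProj (ε : HilbertBasis ℕ ℂ K) (k : ℕ) : HilbertTensor H K →L[ℂ] HilbertTensor H K :=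
  1 - ∑ i ∈ Finset.range k, blockProj ε i

/-- The liminal row seminorm `r_{i,t}(X) = lim_k i_t(E_i X M_k^⊥)`; the sequence is nonincreasing
and nonnegative whenever `N₀` is the indexing of a nest, so the limit exists. -/
def rowSeminorm (N₀ : ℝ → H →L[ℂ] H) (ε : HilbertBasis ℕ ℂ K) (i : ℕ) (t : ℝ)
    (X : HilbertTensor H K →L[ℂ] HilbertTensor H K) : ℝ :=
  limUnder atTop fun k : ℕ => diagSeminorm (ampIndex N₀) t (blockProj ε i * X * tailProj ε k)

/-- The liminal column seminorm `c_{j,t}(X) = lim_k i_t(M_k^⊥ X E_j)`. -/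
def colSeminorm (N₀ : ℝ → H →L[ℂ] H) (ε : HilbertBasis ℕ ℂ K) (j : ℕ) (t : ℝ)
    (X : HilbertTensor H K →L[ℂ] HilbertTensor H K) : ℝ :=
  limUnder atTop fun k : ℕ => diagSeminorm (ampIndex N₀) t (tailProj ε k * X * blockProj ε j)

/-- The set `T(S, R, C)`. -/
def TSRC (𝒩₀ : Set (H →L[ℂ] H)) (N₀ : ℝ → H →L[ℂ] H) (ε : HilbertBasis ℕ ℂ K)
    (S : ℕ → ℕ → Set ℝ) (R C : ℕ → Set ℝ) :
    Set (HilbertTensor H K →L[ℂ] HilbertTensor H K) :=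
  {X | X ∈ nestAlg (ampNest 𝒩₀) ∧
    (∀ i j, ∀ᵐ t ∂(volume.restrict (Set.Icc (0 : ℝ) 1)), t ∉ S i j →
      diagSeminorm (ampIndex N₀) t (blockProj ε i * X * blockProj ε j) = 0) ∧
    (∀ i, ∀ᵐ t ∂(volume.restrict (Set.Icc (0 : ℝ) 1)), t ∉ R i →
      rowSeminorm N₀ ε i t X = 0) ∧
    (∀ j, ∀ᵐ t ∂(volume.restrict (Set.Icc (0 : ℝ) 1)), t ∉ C j →
      colSeminorm N₀ ε j t X = 0)}

end Tensor

/-- An extended triangular system of Borel subsets of `[0,1]`. -/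
structure IsExtendedTriangularSystem (S : ℕ → ℕ → Set ℝ) (R C : ℕ → Set ℝ) : Prop where
  measurableSet_S : ∀ i j, MeasurableSet (S i j)
  measurableSet_R : ∀ i, MeasurableSet (R i)
  measurableSet_C : ∀ j, MeasurableSet (C j)
  S_subset : ∀ i j, S i j ⊆ Set.Icc (0 : ℝ) 1
  R_subset : ∀ i, R i ⊆ Set.Icc (0 : ℝ) 1
  C_subset : ∀ j, C j ⊆ Set.Icc (0 : ℝ) 1
  refl : ∀ i, S i i = Set.Icc (0 : ℝ) 1
  antisymm : ∀ i j, i ≠ j → S i j ∩ S j i = ∅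
  trans : ∀ i j k, S i j ∩ S j k ⊆ S i k
  col : ∀ i j, C i ∩ S i j ⊆ C j
  row : ∀ i j, S i j ∩ R j ⊆ R i
  row_col : ∀ i j, R i ∩ C j ⊆ S i j

end TriangularAlgebras

end

open MeasureTheory Filter Topology
open scoped TensorProduct InnerProductSpace

noncomputable section

set_option linter.unusedSectionVars false

namespace TriangularAlgebras

/-! ### Diagonal seminorms along an increasing family of projections -/

section ProjectionFamily

variable {L : Type*} [NormedAddCommGroup L] [InnerProductSpace ℂ L] [CompleteSpace L]

/-! The algebra property is pointwise in `t`. On the nest algebra, compression to an interval is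
multiplicative, so `i_t` is a submultiplicative seminorm (`diagSeminorm_mul_le`). Inserting `1 =
∑_{l<k} E_l + M_k^⊥` between the factors of `X * Y` splits each block, row tail and column tail of
the product into finitely many terms through single blocks and one term through the tail. Each axiom
of an extended triangular system says that, off the relevant set, one factor of such a term vanishes
or tends to zero. Only countably many null sets are discarded.

For the diagonal, if `X` and `X*` both lie in `T`, then `X` commutes with every `N_t`. For `i ≠ j`,
antisymmetry of `S` makes `i_t` of the `(i, j)` block vanish for a.e. `t`. An operator on `H`
commuting with the nest and having `i_t = 0` a.e. is zero, by Lebesgue differentiation of `‖(N_t -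
N_s) h‖²` (`eq_zero_of_ae_diagSeminorm_eq_zero`). Hence the diagonal is exactly the commutant of all
`N_t` and `E_i` (`mem_TSRC_and_star_mem_iff`).

This commutant is abelian: its elements are block diagonal with blocks in the commutant of `𝒩₀`,
which is abelian because of the cyclic vector (`centralizer_commute_of_cyclic`). It contains all
`N_t` and `E_i`, hence it is maximal abelian. It equals the von Neumann tensor product because the
projections onto the `ε i` lie in `D₀` (`IsMasa.rankOne_mem`). -/

lemma mul_eq_of_star_eq {P Q R : L →L[ℂ] L} (hP : IsSelfAdjoint P) (hQ : IsSelfAdjoint Q)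
    (hR : IsSelfAdjoint R) (h : P * Q = R) : Q * P = R := by
  have := congr_arg star h
  rwa [star_mul, hP.star_eq, hQ.star_eq, hR.star_eq] at this

lemma isSelfAdjoint_one_sub_sum {ι : Type*} (s : Finset ι) {P : ι → L →L[ℂ] L}
    (hP : ∀ i, IsSelfAdjoint (P i)) : IsSelfAdjoint (1 - ∑ i ∈ s, P i) :=
  .sub (.one _) (isSelfAdjoint_sum _ fun i _ => hP i)

/-- An increasing family of projections indexed by the real line. -/
structure IsProjFamily (N : ℝ → L →L[ℂ] L) : Prop where
  proj : ∀ t, IsStarProjection (N t)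
  mul : ∀ s t, N s * N t = N (min s t)

/-- `X` leaves the range of every `N t` invariant. -/
def IsUpper (N : ℝ → L →L[ℂ] L) (X : L →L[ℂ] L) : Prop :=
  ∀ t, N t * X * N t = X * N t

variable {N : ℝ → L →L[ℂ] L}

lemma IsProjFamily.mul_of_le (hN : IsProjFamily N) {s t : ℝ} (h : s ≤ t) : N s * N t = N s := by
  rw [hN.mul, min_eq_left h]

lemma IsProjFamily.mul_of_ge (hN : IsProjFamily N) {s t : ℝ} (h : s ≤ t) : N t * N s = N s := by
  rw [hN.mul, min_eq_right h]

lemma IsProjFamily.commute (hN : IsProjFamily N) (s t : ℝ) : N s * N t = N t * N s := by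
  rw [hN.mul, hN.mul, min_comm]

lemma IsProjFamily.interval (hN : IsProjFamily N) {s t : ℝ} (h : s ≤ t) :
    IsStarProjection (N t - N s) :=
  (hN.proj s).sub_of_mul_eq_left (hN.proj t) (hN.mul_of_le h)

lemma IsProjFamily.interval_mul (hN : IsProjFamily N) {s s' t' t : ℝ} (h₁ : s ≤ s') (h₂ : s' ≤ t')
    (h₃ : t' ≤ t) : (N t' - N s') * (N t - N s) = N t' - N s' := by
  rw [sub_mul, mul_sub, mul_sub, hN.mul_of_le h₃, hN.mul_of_ge (h₁.trans h₂),
    hN.mul_of_le (h₂.trans h₃), hN.mul_of_ge h₁]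
  abel

lemma IsProjFamily.mul_interval (hN : IsProjFamily N) {s s' t' t : ℝ} (h₁ : s ≤ s') (h₂ : s' ≤ t')
    (h₃ : t' ≤ t) : (N t - N s) * (N t' - N s') = N t' - N s' := by
  rw [mul_sub, sub_mul, sub_mul, hN.mul_of_ge h₃, hN.mul_of_le (h₁.trans h₂),
    hN.mul_of_ge (h₂.trans h₃), hN.mul_of_le h₁]
  abel

/-- A smaller interval projection absorbs a larger one on either side. Hence any estimate passes to
subintervals, and several can be made to share one interval. -/
lemma IsProjFamily.norm_interval_mono (hN : IsProjFamily N) {s s' t' t : ℝ} (h₁ : s ≤ s')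
    (h₂ : s' ≤ t') (h₃ : t' ≤ t) (X : L →L[ℂ] L) :
    ‖(N t' - N s') * X * (N t' - N s')‖ ≤ ‖(N t - N s) * X * (N t - N s)‖ := by
  have e : (N t' - N s') * X * (N t' - N s') =
      (N t' - N s') * ((N t - N s) * X * (N t - N s)) * (N t' - N s') := by
    have a := hN.interval_mul h₁ h₂ h₃
    have b := hN.mul_interval h₁ h₂ h₃
    calc _ = ((N t' - N s') * (N t - N s)) * X * ((N t - N s) * (N t' - N s')) := by rw [a, b]
      _ = _ := by simp only [mul_assoc]
  have hn := (hN.interval h₂).norm_le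
  calc _ = ‖(N t' - N s') * ((N t - N s) * X * (N t - N s)) * (N t' - N s')‖ := by rw [e]
    _ ≤ ‖N t' - N s'‖ * ‖(N t - N s) * X * (N t - N s)‖ * ‖N t' - N s'‖ :=
        (norm_mul_le _ _).trans (mul_le_mul_of_nonneg_right (norm_mul_le _ _) (norm_nonneg _))
    _ ≤ 1 * ‖(N t - N s) * X * (N t - N s)‖ * 1 := by gcongr
    _ = _ := by ring

lemma IsUpper.of_commute (hN : IsProjFamily N) {X : L →L[ℂ] L} (h : ∀ t, N t * X = X * N t) :
    IsUpper N X := fun t => by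
  rw [h, mul_assoc, (hN.proj t).isIdempotentElem.eq]

lemma IsUpper.mul {X Y : L →L[ℂ] L} (hX : IsUpper N X) (hY : IsUpper N Y) :
    IsUpper N (X * Y) := fun t => by
  calc N t * (X * Y) * N t = N t * X * (Y * N t) := by simp only [mul_assoc]
    _ = (N t * X * N t) * Y * N t := by rw [← hY t]; simp only [mul_assoc]
    _ = X * (N t * Y * N t) := by rw [hX t]; simp only [mul_assoc]
    _ = _ := by rw [hY t, mul_assoc]

lemma IsUpper.add {X Y : L →L[ℂ] L} (hX : IsUpper N X) (hY : IsUpper N Y) :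
    IsUpper N (X + Y) := fun t => by
  rw [mul_add, add_mul, add_mul, hX t, hY t]

/-- Compression to an interval is multiplicative on the nest algebra. -/
lemma IsUpper.compress_mul (hN : IsProjFamily N) {X Y : L →L[ℂ] L} (hX : IsUpper N X)
    (hY : IsUpper N Y) {s t : ℝ} (h : s ≤ t) :
    (N t - N s) * (X * Y) * (N t - N s) =
      ((N t - N s) * X * (N t - N s)) * ((N t - N s) * Y * (N t - N s)) := by
  have i := (hN.interval h).isIdempotentElem.eq
  -- The interval is semi-invariant: `X` keeps the range of `N s`, which the interval projection
  -- kills, and `Y` keeps the range of `N t`. So the interval projection can be inserted between `X`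
  -- and `Y`.
  have a : (N t - N s) * X * N s = 0 := by
    rw [mul_assoc, ← hX s, ← mul_assoc, ← mul_assoc, sub_mul, hN.mul_of_ge h,
      (hN.proj s).isIdempotentElem.eq, sub_self, zero_mul, zero_mul]
  have b : N t * Y * (N t - N s) = Y * (N t - N s) := by
    rw [mul_sub, mul_sub, hY t]
    congr 1
    calc N t * Y * N s = N t * (N s * Y * N s) := by rw [hY s, mul_assoc]
      _ = (N t * N s) * Y * N s := by simp only [mul_assoc]
      _ = _ := by rw [hN.mul_of_ge h, hY s]
  calc (N t - N s) * (X * Y) * (N t - N s)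
      = (N t - N s) * X * (Y * (N t - N s)) := by simp only [mul_assoc]
    _ = (N t - N s) * X * (N t * Y * (N t - N s)) -
          (N t - N s) * X * N s * (Y * (N t - N s)) := by rw [a, b, zero_mul, sub_zero]
    _ = (N t - N s) * X * (N t * (Y * (N t - N s)) - N s * (Y * (N t - N s))) := by
        simp only [mul_assoc, mul_sub]
    _ = (N t - N s) * X * ((N t - N s) * (Y * (N t - N s))) := by rw [← sub_mul (N t) (N s)]
    _ = (N t - N s) * X * (((N t - N s) * (N t - N s)) * (Y * (N t - N s))) := by rw [i]
    _ = _ := by simp only [mul_assoc]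

lemma diagSeminorm_nonneg (x : ℝ) (X : L →L[ℂ] L) : 0 ≤ diagSeminorm N x X :=
  Real.sInf_nonneg (by rintro _ ⟨s, t, _, _, rfl⟩; exact norm_nonneg _)

lemma diagSeminorm_le {x s t : ℝ} (hs : s < x) (ht : x < t) (X : L →L[ℂ] L) :
    diagSeminorm N x X ≤ ‖(N t - N s) * X * (N t - N s)‖ :=
  csInf_le ⟨0, by rintro _ ⟨s, t, _, _, rfl⟩; exact norm_nonneg _⟩ ⟨s, t, hs, ht, rfl⟩

lemma exists_interval_of_diagSeminorm_lt {x c : ℝ} {X : L →L[ℂ] L}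
    (h : diagSeminorm N x X < c) :
    ∃ s t : ℝ, s < x ∧ x < t ∧ ‖(N t - N s) * X * (N t - N s)‖ < c := by
  obtain ⟨_, ⟨s, t, hs, ht, rfl⟩, hc⟩ := exists_lt_of_csInf_lt
    (by exact ⟨_, x - 1, x + 1, by linarith, by linarith, rfl⟩) h
  exact ⟨s, t, hs, ht, hc⟩

@[simp] lemma diagSeminorm_zero (x : ℝ) : diagSeminorm N x 0 = 0 :=
  le_antisymm ((diagSeminorm_le (sub_one_lt x) (lt_add_one x) 0).trans (by simp))
    (diagSeminorm_nonneg x 0)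

lemma diagSeminorm_le_norm (hN : IsProjFamily N) (x : ℝ) (X : L →L[ℂ] L) :
    diagSeminorm N x X ≤ ‖X‖ := by
  refine (diagSeminorm_le (sub_one_lt x) (lt_add_one x) X).trans ?_
  have hn := (hN.interval (show x - 1 ≤ x + 1 by linarith)).norm_le
  calc _ ≤ ‖N (x + 1) - N (x - 1)‖ * ‖X‖ * ‖N (x + 1) - N (x - 1)‖ :=
        (norm_mul_le _ _).trans (mul_le_mul_of_nonneg_right (norm_mul_le _ _) (norm_nonneg _))
    _ ≤ 1 * ‖X‖ * 1 := by gcongr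
    _ = _ := by ring

/-- Two operators can be controlled on one common interval. -/
lemma exists_common_interval (hN : IsProjFamily N) {x c d : ℝ} {X Y : L →L[ℂ] L}
    (hc : diagSeminorm N x X < c) (hd : diagSeminorm N x Y < d) :
    ∃ s t : ℝ, s < x ∧ x < t ∧ ‖(N t - N s) * X * (N t - N s)‖ < c ∧
      ‖(N t - N s) * Y * (N t - N s)‖ < d := by
  obtain ⟨s, t, hs, ht, h⟩ := exists_interval_of_diagSeminorm_lt hc
  obtain ⟨s', t', hs', ht', h'⟩ := exists_interval_of_diagSeminorm_lt hd
  have hs'' := max_lt hs hs'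
  have ht'' := lt_min ht ht'
  exact ⟨max s s', min t t', hs'', ht'',
    (hN.norm_interval_mono (le_max_left _ _) (hs''.trans ht'').le (min_le_left _ _) X).trans_lt h,
    (hN.norm_interval_mono (le_max_right _ _) (hs''.trans ht'').le (min_le_right _ _) Y).trans_lt h'⟩

lemma diagSeminorm_add_le (hN : IsProjFamily N) (x : ℝ) (X Y : L →L[ℂ] L) :
    diagSeminorm N x (X + Y) ≤ diagSeminorm N x X + diagSeminorm N x Y := by
  refine le_of_forall_pos_le_add fun δ hδ => ?_
  obtain ⟨s, t, hs, ht, h, h'⟩ := exists_common_interval hN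
    (lt_add_of_pos_right (diagSeminorm N x X) (half_pos hδ))
    (lt_add_of_pos_right (diagSeminorm N x Y) (half_pos hδ))
  refine (diagSeminorm_le hs ht _).trans ?_
  rw [mul_add, add_mul]
  exact (norm_add_le _ _).trans (by linarith)

lemma diagSeminorm_sum_le (hN : IsProjFamily N) (x : ℝ) {ι : Type*} (s : Finset ι)
    (X : ι → L →L[ℂ] L) :
    diagSeminorm N x (∑ i ∈ s, X i) ≤ ∑ i ∈ s, diagSeminorm N x (X i) := by
  classical
  induction s using Finset.induction_on with
  | empty => simp
  | insert a s ha ih =>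
    rw [Finset.sum_insert ha, Finset.sum_insert ha]
    exact (diagSeminorm_add_le hN x _ _).trans (by gcongr)

lemma diagSeminorm_mul_le (hN : IsProjFamily N) (x : ℝ) {X Y : L →L[ℂ] L} (hX : IsUpper N X)
    (hY : IsUpper N Y) :
    diagSeminorm N x (X * Y) ≤ diagSeminorm N x X * diagSeminorm N x Y := by
  -- The infima need not be attained; a slack `δ` is allowed in each factor and then sent to zero.
  have key : ∀ δ > 0, diagSeminorm N x (X * Y) ≤
      (diagSeminorm N x X + δ) * (diagSeminorm N x Y + δ) := fun δ hδ => by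
    obtain ⟨s, t, hs, ht, h, h'⟩ := exists_common_interval hN
      (lt_add_of_pos_right (diagSeminorm N x X) hδ)
      (lt_add_of_pos_right (diagSeminorm N x Y) hδ)
    refine (diagSeminorm_le hs ht _).trans ?_
    rw [hX.compress_mul hN hY (hs.trans ht).le]
    exact (norm_mul_le _ _).trans (mul_le_mul h.le h'.le (norm_nonneg _)
      (by linarith [diagSeminorm_nonneg (N := N) x X]))
  have ht : Tendsto (fun δ : ℝ => (diagSeminorm N x X + δ) * (diagSeminorm N x Y + δ)) (𝓝[>] 0)
      (𝓝 ((diagSeminorm N x X + 0) * (diagSeminorm N x Y + 0))) :=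
    (Continuous.tendsto (by fun_prop) 0).mono_left nhdsWithin_le_nhds
  simpa using ge_of_tendsto ht (eventually_nhdsWithin_of_forall key)

lemma diagSeminorm_star (hN : IsProjFamily N) (x : ℝ) (X : L →L[ℂ] L) :
    diagSeminorm N x (star X) = diagSeminorm N x X := by
  unfold diagSeminorm
  congr 1
  ext c
  refine exists_congr fun s => exists_congr fun t => and_congr_right fun hs =>
    and_congr_right fun ht => ?_
  have e := (hN.interval (hs.trans ht).le).isSelfAdjoint.star_eq
  have : (N t - N s) * star X * (N t - N s) = star ((N t - N s) * X * (N t - N s)) := by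
    rw [star_mul, star_mul, e, mul_assoc]
  rw [this, norm_star]

end ProjectionFamily

/-! ### Elementary tensors, blocks and block projections -/

section TensorSlots

variable {H K : Type*} [NormedAddCommGroup H] [InnerProductSpace ℂ H] [CompleteSpace H]
  [NormedAddCommGroup K] [InnerProductSpace ℂ K] [CompleteSpace K]

lemma tensorOp_coe_tmul (A : H →L[ℂ] H) (B : K →L[ℂ] K) (x : H) (y : K) :
    tensorOp A B ((x ⊗ₜ[ℂ] y : H ⊗[ℂ] K) : HilbertTensor H K) =
      ((A x ⊗ₜ[ℂ] B y : H ⊗[ℂ] K) : HilbertTensor H K) := by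
  simp [tensorOp]

/-- The embedding `h ↦ h ⊗ y`. -/
def tensorRight (y : K) : H →L[ℂ] HilbertTensor H K :=
  (UniformSpace.Completion.toComplL : H ⊗[ℂ] K →L[ℂ] HilbertTensor H K) ∘L
    (TensorProduct.mkL ℂ H K).flip y

lemma tensorRight_apply (y : K) (x : H) :
    tensorRight y x = ((x ⊗ₜ[ℂ] y : H ⊗[ℂ] K) : HilbertTensor H K) := rfl

lemma inner_tensorRight (y y' : K) (x x' : H) :
    ⟪tensorRight y x, tensorRight y' x'⟫_ℂ = ⟪x, x'⟫_ℂ * ⟪y, y'⟫_ℂ := by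
  rw [tensorRight_apply, tensorRight_apply, UniformSpace.Completion.inner_coe,
    TensorProduct.inner_tmul]

lemma tensorOp_tensorRight (A : H →L[ℂ] H) (B : K →L[ℂ] K) (y : K) (x : H) :
    tensorOp A B (tensorRight y x) = tensorRight (B y) (A x) :=
  tensorOp_coe_tmul A B x y

lemma tensorRight_add (y y' : K) (x : H) :
    tensorRight (y + y') x = tensorRight y x + tensorRight y' x := by
  simp [tensorRight]

lemma tensorRight_smul (c : ℂ) (y : K) (x : H) :
    tensorRight (c • y) x = c • tensorRight y x := by
  simp [tensorRight]

lemma continuous_tensorRight (x : H) : Continuous fun y : K => tensorRight y x :=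
  ((UniformSpace.Completion.toComplL : H ⊗[ℂ] K →L[ℂ] HilbertTensor H K) ∘L
    (TensorProduct.mkL ℂ H K) x).continuous

lemma ext_tensorRight {F : Type*} [NormedAddCommGroup F] [NormedSpace ℂ F]
    {X Y : HilbertTensor H K →L[ℂ] F} (h : ∀ y x, X (tensorRight y x) = Y (tensorRight y x)) :
    X = Y := by
  ext v
  induction v using UniformSpace.Completion.induction_on with
  | hp => exact isClosed_eq X.continuous Y.continuous
  | ih v =>
    induction v using TensorProduct.induction_on with
    | zero => exact (map_zero X).trans (map_zero Y).symm
    | tmul x y => exact h y x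
    | add a b ha hb => rw [UniformSpace.Completion.coe_add, map_add, map_add, ha, hb]

/-- Operators on the tensor product agree as soon as they agree on the vectors `x ⊗ ε i`. -/
lemma ext_basis {F : Type*} [NormedAddCommGroup F] [NormedSpace ℂ F] (ε : HilbertBasis ℕ ℂ K)
    {X Y : HilbertTensor H K →L[ℂ] F}
    (h : ∀ i x, X (tensorRight (ε i) x) = Y (tensorRight (ε i) x)) : X = Y := by
  refine ext_tensorRight fun y x => ?_
  have hd : Dense (Submodule.span ℂ (Set.range ε) : Set K) := by
    rw [Submodule.dense_iff_topologicalClosure_eq_top]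
    exact ε.dense_span
  refine hd.induction (P := fun y => X (tensorRight y x) = Y (tensorRight y x)) (fun y hy => ?_)
    (isClosed_eq (X.continuous.comp (continuous_tensorRight x))
      (Y.continuous.comp (continuous_tensorRight x))) y
  induction hy using Submodule.span_induction with
  | mem y hy => obtain ⟨i, rfl⟩ := hy; exact h i x
  | zero => simp [tensorRight]
  | add a b _ _ ha hb => simp only [tensorRight_add, map_add, ha, hb]
  | smul c a _ ha => simp only [tensorRight_smul, map_smul, ha]

lemma tensorOp_mul (A A' : H →L[ℂ] H) (B B' : K →L[ℂ] K) :
    tensorOp A B * tensorOp A' B' = tensorOp (A * A') (B * B') :=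
  ext_tensorRight fun y x => by
    simp only [mul_apply_eq_comp, tensorOp_tensorRight]

lemma tensorOp_one : tensorOp (1 : H →L[ℂ] H) (1 : K →L[ℂ] K) = 1 :=
  ext_tensorRight fun y x => by simp [tensorOp_tensorRight]

lemma tensorOp_zero_left (B : K →L[ℂ] K) : tensorOp (0 : H →L[ℂ] H) B = 0 :=
  ext_tensorRight fun y x => by simp [tensorOp_tensorRight]

lemma star_tensorOp (A : H →L[ℂ] H) (B : K →L[ℂ] K) :
    star (tensorOp A B) = tensorOp (star A) (star B) := by
  refine ext_tensorRight fun y x => ?_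
  refine ext_inner_left ℂ fun v => ?_
  -- With one elementary tensor fixed, both functionals need comparing only on elementary tensors,
  -- where inner products factor. Conjugation then swaps the arguments.
  have : innerSL ℂ (star (tensorOp A B) (tensorRight y x)) =
      innerSL ℂ (tensorOp (star A) (star B) (tensorRight y x)) := by
    refine ext_tensorRight fun y' x' => ?_
    simp only [innerSL_apply_apply, ContinuousLinearMap.star_eq_adjoint,
      ContinuousLinearMap.adjoint_inner_left, tensorOp_tensorRight, inner_tensorRight]
  have h := congr(starRingEnd ℂ ($this v))
  simpa only [innerSL_apply_apply, inner_conj_symm] using h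

lemma isStarProjection_tensorOp {A : H →L[ℂ] H} {B : K →L[ℂ] K} (hA : IsStarProjection A)
    (hB : IsStarProjection B) : IsStarProjection (tensorOp A B) := by
  refine ⟨?_, ?_⟩
  · rw [IsIdempotentElem, tensorOp_mul, hA.isIdempotentElem.eq, hB.isIdempotentElem.eq]
  · rw [isSelfAdjoint_iff, star_tensorOp, hA.isSelfAdjoint.star_eq, hB.isSelfAdjoint.star_eq]

/-- The `(i, j)` block of an operator on the tensor product. -/
def block (ε : HilbertBasis ℕ ℂ K) (i j : ℕ) (X : HilbertTensor H K →L[ℂ] HilbertTensor H K) :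
    H →L[ℂ] H :=
  (tensorRight (ε i)).adjoint ∘L X ∘L tensorRight (ε j)

lemma basis_inner (ε : HilbertBasis ℕ ℂ K) (i j : ℕ) : ⟪ε i, ε j⟫_ℂ = if i = j then 1 else 0 :=
  orthonormal_iff_ite.mp ε.orthonormal i j

lemma blockProj_tensorRight (ε : HilbertBasis ℕ ℂ K) (i j : ℕ) (x : H) :
    blockProj ε i (tensorRight (ε j) x) = if i = j then tensorRight (ε j) x else 0 := by
  rw [blockProj, tensorOp_tensorRight, InnerProductSpace.rankOne_apply, basis_inner]
  split_ifs with h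
  · subst h; simp
  · simp [tensorRight]

lemma adjoint_tensorRight_apply (y y' : K) (x : H) :
    (tensorRight (H := H) y).adjoint (tensorRight y' x) = ⟪y, y'⟫_ℂ • x := by
  refine ext_inner_left ℂ fun v => ?_
  rw [ContinuousLinearMap.adjoint_inner_right, inner_tensorRight, inner_smul_right, mul_comm]

lemma blockProj_eq (ε : HilbertBasis ℕ ℂ K) (i : ℕ) :
    blockProj (H := H) ε i = tensorRight (ε i) ∘L (tensorRight (ε i)).adjoint := by
  refine ext_basis ε fun j x => ?_
  rw [blockProj_tensorRight, ContinuousLinearMap.comp_apply, adjoint_tensorRight_apply,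
    basis_inner]
  split_ifs with h
  · subst h; simp
  · simp

lemma norm_tensorRight_basis (ε : HilbertBasis ℕ ℂ K) (i : ℕ) (x : H) :
    ‖tensorRight (ε i) x‖ = ‖x‖ := by
  rw [tensorRight_apply, UniformSpace.Completion.norm_coe, TensorProduct.norm_tmul,
    ε.orthonormal.1 i, mul_one]

lemma isStarProjection_blockProj (ε : HilbertBasis ℕ ℂ K) (i : ℕ) :
    IsStarProjection (blockProj (H := H) ε i) :=
  isStarProjection_tensorOp (.one _)
    (InnerProductSpace.isStarProjection_rankOne_self (ε.orthonormal.1 i))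

lemma blockProj_mul_of_ne (ε : HilbertBasis ℕ ℂ K) {i j : ℕ} (h : i ≠ j) :
    blockProj (H := H) ε i * blockProj ε j = 0 := by
  refine ext_basis ε fun k x => ?_
  rw [mul_apply_eq_comp, blockProj_tensorRight]
  split_ifs with hk
  · subst hk; rw [blockProj_tensorRight, if_neg h]; rfl
  · simp

/-- The tail removes the blocks of index strictly below `k`, so block `j` is killed only once `k >
j`. -/
lemma tailProj_tensorRight (ε : HilbertBasis ℕ ℂ K) (k j : ℕ) (x : H) :
    tailProj ε k (tensorRight (ε j) x) = if j < k then 0 else tensorRight (ε j) x := by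
  simp only [tailProj, sub_apply, one_apply_eq_self,
    sum_apply, blockProj_tensorRight, Finset.sum_ite_eq', Finset.mem_range]
  split_ifs <;> simp

lemma tailProj_mul (ε : HilbertBasis ℕ ℂ K) {k l : ℕ} (h : k ≤ l) :
    tailProj (H := H) ε k * tailProj ε l = tailProj ε l := by
  refine ext_basis ε fun j x => ?_
  rw [mul_apply_eq_comp, tailProj_tensorRight]
  split_ifs with hj
  · simp
  · rw [tailProj_tensorRight, if_neg (by omega)]

lemma isStarProjection_tailProj (ε : HilbertBasis ℕ ℂ K) (k : ℕ) :
    IsStarProjection (tailProj (H := H) ε k) := by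
  exact ⟨tailProj_mul ε le_rfl,
    isSelfAdjoint_one_sub_sum _ fun i => (isStarProjection_blockProj ε i).isSelfAdjoint⟩

lemma tailProj_mul' (ε : HilbertBasis ℕ ℂ K) {k l : ℕ} (h : k ≤ l) :
    tailProj (H := H) ε l * tailProj ε k = tailProj ε l :=
  mul_eq_of_star_eq (isStarProjection_tailProj ε k).isSelfAdjoint
    (isStarProjection_tailProj ε l).isSelfAdjoint (isStarProjection_tailProj ε l).isSelfAdjoint
    (tailProj_mul ε h)

lemma blockProj_mul_tailProj (ε : HilbertBasis ℕ ℂ K) {i k : ℕ} (h : i < k) :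
    blockProj (H := H) ε i * tailProj ε k = 0 := by
  refine ext_basis ε fun j x => ?_
  rw [mul_apply_eq_comp, tailProj_tensorRight]
  split_ifs with hj
  · simp
  · rw [blockProj_tensorRight, if_neg (by omega)]; rfl

lemma tailProj_mul_blockProj (ε : HilbertBasis ℕ ℂ K) {i k : ℕ} (h : i < k) :
    tailProj (H := H) ε k * blockProj ε i = 0 :=
  mul_eq_of_star_eq (isStarProjection_blockProj ε i).isSelfAdjoint
    (isStarProjection_tailProj ε k).isSelfAdjoint (.zero _) (blockProj_mul_tailProj ε h)

/-- The partition of the identity into the first `k` blocks and the tail. -/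
lemma sum_blockProj_add_tailProj (ε : HilbertBasis ℕ ℂ K) (k : ℕ) :
    ∑ i ∈ Finset.range k, blockProj (H := H) ε i + tailProj ε k = 1 := by
  rw [tailProj]; abel

lemma blockProj_comp_tensorRight (ε : HilbertBasis ℕ ℂ K) (i : ℕ) :
    blockProj (H := H) ε i ∘L tensorRight (ε i) = tensorRight (ε i) := by
  ext x; rw [ContinuousLinearMap.comp_apply, blockProj_tensorRight, if_pos rfl]

lemma tensorOp_rankOne_eq (ε : HilbertBasis ℕ ℂ K) (i : ℕ) (A : H →L[ℂ] H) :
    tensorOp A (InnerProductSpace.rankOne ℂ (ε i) (ε i)) =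
      tensorRight (ε i) ∘L A ∘L (tensorRight (ε i)).adjoint := by
  refine ext_basis ε fun j x => ?_
  simp only [ContinuousLinearMap.comp_apply, adjoint_tensorRight_apply, tensorOp_tensorRight,
    basis_inner, InnerProductSpace.rankOne_apply]
  split_ifs with h
  · subst h; simp
  · rw [zero_smul, zero_smul, map_zero, map_zero, tensorRight, map_zero,
      ContinuousLinearMap.comp_zero, zero_apply]

/-- Lets the vanishing of a block, an operator on `H`, be carried back to the tensor product. -/
lemma blockProj_mul_mul_blockProj (ε : HilbertBasis ℕ ℂ K) (i j : ℕ)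
    (X : HilbertTensor H K →L[ℂ] HilbertTensor H K) :
    blockProj ε i * X * blockProj ε j =
      tensorRight (ε i) ∘L block ε i j X ∘L (tensorRight (ε j)).adjoint := by
  rw [blockProj_eq, blockProj_eq]; rfl

lemma block_blockProj (ε : HilbertBasis ℕ ℂ K) (i j : ℕ)
    (X : HilbertTensor H K →L[ℂ] HilbertTensor H K) :
    block ε i j (blockProj ε i * X * blockProj ε j) = block ε i j X := by
  ext x
  refine ext_inner_left ℂ fun v => ?_
  simp only [block, ContinuousLinearMap.comp_apply, mul_apply_eq_comp,
    blockProj_tensorRight, if_true, ContinuousLinearMap.adjoint_inner_right]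
  rw [← ContinuousLinearMap.adjoint_inner_left, ← ContinuousLinearMap.star_eq_adjoint,
    (isStarProjection_blockProj ε i).isSelfAdjoint.star_eq, blockProj_tensorRight, if_pos rfl]

/-- Compressing a block by `F` and `G` amounts to compressing by `F ⊗ 1` and `G ⊗ 1`. -/
lemma block_tensorOp (ε : HilbertBasis ℕ ℂ K) (i j : ℕ) (F G : H →L[ℂ] H)
    (X : HilbertTensor H K →L[ℂ] HilbertTensor H K) :
    block ε i j (tensorOp F 1 * X * tensorOp G 1) = F * block ε i j X * G := by
  ext x
  refine ext_inner_left ℂ fun v => ?_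
  simp only [block, ContinuousLinearMap.comp_apply, mul_apply_eq_comp,
    tensorOp_tensorRight, one_apply_eq_self, ContinuousLinearMap.adjoint_inner_right]
  rw [← ContinuousLinearMap.adjoint_inner_left, ← ContinuousLinearMap.star_eq_adjoint,
    star_tensorOp, star_one, tensorOp_tensorRight, one_apply_eq_self,
    ← ContinuousLinearMap.adjoint_inner_left F, ContinuousLinearMap.adjoint_inner_right,
    ContinuousLinearMap.star_eq_adjoint]

lemma norm_block_le (ε : HilbertBasis ℕ ℂ K) (i j : ℕ)
    (X : HilbertTensor H K →L[ℂ] HilbertTensor H K) : ‖block ε i j X‖ ≤ ‖X‖ := by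
  have h : ∀ i, ‖tensorRight (H := H) (ε i)‖ ≤ 1 := fun i =>
    ContinuousLinearMap.opNorm_le_bound _ zero_le_one fun x => by
      rw [norm_tensorRight_basis, one_mul]
  calc ‖block ε i j X‖ ≤ ‖(tensorRight (H := H) (ε i)).adjoint‖ *
        (‖X‖ * ‖tensorRight (H := H) (ε j)‖) :=
        (ContinuousLinearMap.opNorm_comp_le _ _).trans
          (mul_le_mul_of_nonneg_left (ContinuousLinearMap.opNorm_comp_le _ _) (norm_nonneg _))
    _ ≤ 1 * (‖X‖ * 1) := by
        rw [LinearIsometryEquiv.norm_map]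
        gcongr <;> exact h _
    _ = ‖X‖ := by ring

end TensorSlots

/-! ### Atoms of a masa and their eigenvectors -/

section Masa

variable {L : Type*} [NormedAddCommGroup L] [InnerProductSpace ℂ L] [CompleteSpace L]

/-- Self-adjointness of `A` keeps `D ∪ {A}` closed under `star`, so it generates a commutative star
subalgebra, which maximality forces back into `D`. -/
lemma IsMasa.mem_of_commute {D : StarSubalgebra ℂ (L →L[ℂ] L)} (hD : IsMasa D) {A : L →L[ℂ] L}
    (hA : IsSelfAdjoint A) (hAD : ∀ B ∈ D, A * B = B * A) : A ∈ D := by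
  have hc : ∀ x ∈ insert A (D : Set (L →L[ℂ] L)), ∀ y ∈ insert A (D : Set (L →L[ℂ] L)),
      x * y = y * x := by
    rintro x (rfl | hx) y (rfl | hy)
    · rfl
    · exact hAD y hy
    · exact (hAD x hx).symm
    · exact hD.1 x hx y hy
  have hs : ∀ x ∈ insert A (D : Set (L →L[ℂ] L)), star x ∈ insert A (D : Set (L →L[ℂ] L)) := by
    rintro x (rfl | hx)
    · exact Or.inl hA.star_eq
    · exact Or.inr (star_mem hx)
  have hcomm := StarAlgebra.isMulCommutative_adjoin ℂ hc fun a ha b hb => hc a ha _ (hs b hb)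
  have hle : D ≤ StarAlgebra.adjoin ℂ (insert A (D : Set (L →L[ℂ] L))) := fun x hx =>
    StarAlgebra.subset_adjoin ℂ _ (Set.mem_insert_of_mem _ hx)
  refine hD.le_of_ge (fun x hx y hy => ?_) hle (StarAlgebra.subset_adjoin ℂ _ (Set.mem_insert A _))
  exact congr_arg Subtype.val (hcomm.is_comm.comm ⟨x, hx⟩ ⟨y, hy⟩)

lemma starProjection_commute_of_invariant {M : Submodule ℂ L} [M.HasOrthogonalProjection]
    {B : L →L[ℂ] L} (h : ∀ v ∈ M, B v ∈ M) (h' : ∀ v ∈ M, star B v ∈ M) :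
    M.starProjection * B = B * M.starProjection := by
  have key : ∀ C : L →L[ℂ] L, (∀ v ∈ M, C v ∈ M) →
      M.starProjection * C * M.starProjection = C * M.starProjection := fun C hC => by
    ext v
    exact Submodule.starProjection_eq_self_iff.mpr (hC _ (Submodule.starProjection_apply_mem _ v))
  have hsa : star M.starProjection = M.starProjection := isStarProjection_starProjection.isSelfAdjoint
  have := congr_arg star (key _ h')
  rw [star_mul, star_mul, star_mul, star_star, hsa] at this
  rw [← this, ← mul_assoc, key _ h]

/-- An element of a masa either vanishes on an atom or is injective on it. -/
lemma IsMasa.injOn_atom {D : StarSubalgebra ℂ (L →L[ℂ] L)} (hD : IsMasa D) {P : L →L[ℂ] L}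
    (hP : IsAtomOf D P) {A : L →L[ℂ] L} (hA : A ∈ D) :
    (∀ v, P v = v → A v = 0) ∨ (∀ v, P v = v → A v = 0 → v = 0) := by
  rw [or_iff_not_imp_right]
  intro hne
  push Not at hne
  obtain ⟨w, hw, hAw, hw0⟩ := hne
  -- The part of `ker A` inside the atom is invariant under `D`, so its projection lies in `D` and
  -- below `P`. If nonzero, it equals `P` by minimality.
  let M : Submodule ℂ L := A.ker ⊓ (P - 1).ker
  have hmem : ∀ v, v ∈ M ↔ A v = 0 ∧ P v = v := fun v => by
    simp [M, sub_eq_zero]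
  have hclosed : IsClosed (M : Set L) := (A.isClosed_ker).inter (P - 1).isClosed_ker
  have : CompleteSpace M := hclosed.completeSpace_coe
  have hinv : ∀ B ∈ D, ∀ v ∈ M, B v ∈ M := fun B hB v hv => by
    rw [hmem] at hv ⊢
    have h1 := congr($(hD.1 A hA B hB) v)
    have h2 := congr($(hD.1 P hP.1.1 B hB) v)
    simp only [mul_apply_eq_comp] at h1 h2
    rw [h1, h2, hv.1, hv.2, map_zero]
    exact ⟨rfl, rfl⟩
  have hQD : M.starProjection ∈ D := hD.mem_of_commute
    isStarProjection_starProjection.isSelfAdjoint fun B hB =>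
      starProjection_commute_of_invariant (hinv B hB) (hinv _ (star_mem hB))
  have hwM : M.starProjection w = w :=
    Submodule.starProjection_eq_self_iff.mpr ((hmem w).mpr ⟨hAw, hw⟩)
  have hQ0 : M.starProjection ≠ 0 := fun h => hw0 (by rw [← hwM, h]; rfl)
  have hQP : M.starProjection ≤ P := by
    rw [isStarProjection_starProjection.le_iff_mul_eq_right hP.1.2.1]
    ext v
    exact ((hmem _).mp (Submodule.starProjection_apply_mem M v)).2
  have hPQ := hP.2 ⟨hQD, isStarProjection_starProjection, hQ0⟩ hQP
  rw [hP.1.2.1.le_iff_mul_eq_right isStarProjection_starProjection] at hPQ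
  intro v hv
  have := congr($hPQ v)
  rw [mul_apply_eq_comp, hv] at this
  exact ((hmem v).mp (Submodule.starProjection_eq_self_iff.mp this)).1

lemma apply_eq_zero_of_inner_eq_zero {T : L →L[ℂ] L} (hT : 0 ≤ T) {x : L}
    (h : ⟪x, T x⟫_ℂ = 0) : T x = 0 := by
  obtain ⟨S, rfl⟩ := CStarAlgebra.nonneg_iff_eq_star_mul_self.mp hT
  rw [mul_apply_eq_comp, ContinuousLinearMap.star_eq_adjoint,
    ContinuousLinearMap.adjoint_inner_right, inner_self_eq_zero] at h
  rw [mul_apply_eq_comp, h, map_zero]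

/-- Subtracting the mean `c = ⟪x, A x⟫` gives `B` in `D` with `⟪x, B x⟫ = 0`. Since `B⁺ B⁻ = 0` and
`B⁺` is either zero or injective on the atom, one of `B⁺ x`, `B⁻ x` vanishes. The other is then a
positive operator with zero expectation at `x`, so it kills `x` too. -/
lemma IsMasa.eigenvector_of_isSelfAdjoint {D : StarSubalgebra ℂ (L →L[ℂ] L)} (hD : IsMasa D)
    {P : L →L[ℂ] L} (hP : IsAtomOf D P) {x : L} (hx : ‖x‖ = 1) (hPx : P x = x) {A : L →L[ℂ] L}
    (hA : A ∈ D) (hsa : IsSelfAdjoint A) : ∃ c : ℂ, A x = c • x := by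
  set c : ℝ := RCLike.re ⟪x, A x⟫_ℂ with hc
  have hc' : ⟪x, A x⟫_ℂ = (c : ℂ) := by
    refine (Complex.conj_eq_iff_re.mp ?_).symm
    rw [inner_conj_symm, ← ContinuousLinearMap.adjoint_inner_right,
      ← ContinuousLinearMap.star_eq_adjoint, hsa.star_eq]
  set B : L →L[ℂ] L := A - algebraMap ℂ (L →L[ℂ] L) c with hB
  have hBx : B x = A x - (c : ℂ) • x := by simp [hB, Algebra.algebraMap_eq_smul_one]
  have hBsa : IsSelfAdjoint B := hsa.sub (by
    rw [isSelfAdjoint_iff, ← algebraMap_star_comm]; simp)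
  have hBD : B ∈ D := sub_mem hA (D.algebraMap_mem _)
  have hinner : ⟪x, B x⟫_ℂ = 0 := by
    rw [hBx, inner_sub_right, inner_smul_right, hc', inner_self_eq_norm_sq_to_K, hx]; simp
  have hpos : B⁺ ∈ D := hD.mem_of_commute (CFC.posPart_nonneg B).isSelfAdjoint fun C hC => by
    rw [CFC.posPart_def]
    exact (hBsa.commute_cfcₙ (show Commute B C from hD.1 B hBD C hC) _).eq
  have hneg : B⁻ ∈ D := hD.mem_of_commute (CFC.negPart_nonneg B).isSelfAdjoint fun C hC => by
    rw [CFC.negPart_def]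
    exact (hBsa.commute_cfcₙ (show Commute B C from hD.1 B hBD C hC) _).eq
  have hsub : B⁺ x - B⁻ x = B x := congr($(CFC.posPart_sub_negPart B hBsa) x)
  have hzero : B⁺ x = 0 ∨ B⁻ x = 0 := by
    rcases hD.injOn_atom hP hpos with h | h
    · exact Or.inl (h x hPx)
    -- `B⁻ x` stays in the atom because `B⁻` commutes with `P`, and `B⁺` annihilates it.
    · refine Or.inr (h _ ?_ ?_)
      · have := congr($(hD.1 P hP.1.1 _ hneg) x)
        rwa [mul_apply_eq_comp, mul_apply_eq_comp, hPx] at this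
      · exact congr($(CFC.posPart_mul_negPart B) x)
  have hBx0 : B x = 0 := by
    rcases hzero with h | h
    · rw [h, zero_sub] at hsub
      have : B⁻ x = 0 := apply_eq_zero_of_inner_eq_zero (CFC.negPart_nonneg B) (by
        rw [← hsub, inner_neg_right, neg_eq_zero] at hinner; exact hinner)
      rw [← hsub, this, neg_zero]
    · rw [h, sub_zero] at hsub
      rw [← hsub]
      exact apply_eq_zero_of_inner_eq_zero (CFC.posPart_nonneg B) (by rw [hsub]; exact hinner)
  exact ⟨c, sub_eq_zero.mp (hBx ▸ hBx0)⟩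

lemma IsMasa.eigenvector {D : StarSubalgebra ℂ (L →L[ℂ] L)} (hD : IsMasa D)
    {P : L →L[ℂ] L} (hP : IsAtomOf D P) {x : L} (hx : ‖x‖ = 1) (hPx : P x = x) {A : L →L[ℂ] L}
    (hA : A ∈ D) : ∃ c : ℂ, A x = c • x := by
  have hs := star_mem hA
  have hre : (realPart A : L →L[ℂ] L) ∈ D := by
    rw [realPart_apply_coe, ← Complex.coe_smul]
    exact D.smul_mem (add_mem hA hs) _
  have him : (imaginaryPart A : L →L[ℂ] L) ∈ D := by
    rw [imaginaryPart_apply_coe, ← Complex.coe_smul]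
    exact D.smul_mem (D.smul_mem (sub_mem hA hs) _) _
  obtain ⟨a, ha⟩ := hD.eigenvector_of_isSelfAdjoint hP hx hPx hre (realPart A).2
  obtain ⟨b, hb⟩ := hD.eigenvector_of_isSelfAdjoint hP hx hPx him (imaginaryPart A).2
  refine ⟨a + Complex.I * b, ?_⟩
  conv_lhs => rw [← realPart_add_I_smul_imaginaryPart A]
  rw [add_apply, smul_apply, ha, hb, smul_smul, add_smul]

/-- The rank one projection onto a unit vector in an atom of a masa belongs to the masa. -/
lemma IsMasa.rankOne_mem {D : StarSubalgebra ℂ (L →L[ℂ] L)} (hD : IsMasa D)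
    {P : L →L[ℂ] L} (hP : IsAtomOf D P) {x : L} (hx : ‖x‖ = 1) (hPx : P x = x) :
    InnerProductSpace.rankOne ℂ x x ∈ D := by
  refine hD.mem_of_commute (InnerProductSpace.isStarProjection_rankOne_self hx).isSelfAdjoint
    fun A hA => ?_
  obtain ⟨a, ha⟩ := hD.eigenvector hP hx hPx hA
  obtain ⟨b, hb⟩ := hD.eigenvector hP hx hPx (star_mem hA)
  -- The eigenvalues of `A` and `star A` at `x` are conjugate, which is what commutation with the
  -- rank one projection needs.
  have hab : (starRingEnd ℂ) b = a := by
    have h : ⟪star A x, x⟫_ℂ = ⟪x, A x⟫_ℂ := by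
      rw [ContinuousLinearMap.star_eq_adjoint, ContinuousLinearMap.adjoint_inner_left]
    rw [ha, hb, inner_smul_left, inner_smul_right, inner_self_eq_norm_sq_to_K, hx] at h
    simpa using h
  ext v
  rw [mul_apply_eq_comp, mul_apply_eq_comp, InnerProductSpace.rankOne_apply,
    InnerProductSpace.rankOne_apply, map_smul, ha, ← ContinuousLinearMap.adjoint_inner_left,
    ← ContinuousLinearMap.star_eq_adjoint, hb, inner_smul_left, hab, smul_smul, mul_comm]

end Masa

/-! ### Commutants in the presence of a cyclic vector -/

section Cyclic

variable {L : Type*} [NormedAddCommGroup L] [InnerProductSpace ℂ L] [CompleteSpace L]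

lemma star_mem_centralizer_of_star_mem {s : Set (L →L[ℂ] L)} (hs : ∀ P ∈ s, star P ∈ s)
    {A : L →L[ℂ] L} (hA : A ∈ Set.centralizer s) : star A ∈ Set.centralizer s := fun P hP => by
  have := congr_arg star (hA _ (hs P hP))
  rw [star_mul, star_mul, star_star] at this
  exact this.symm

/-- Approximate `T ξ` by `A n ξ` with `A n` in the abelian bicommutant. Moving `A n` across the
inner product as `star (A n)` and passing to the limit on both sides puts `T` on the other side of
`S`. -/
lemma centralizer_commute_of_isSelfAdjoint {s : Set (L →L[ℂ] L)} (hs : ∀ P ∈ s, star P ∈ s)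
    (hcomm : ∀ P ∈ s, ∀ Q ∈ s, P * Q = Q * P) {ξ : L}
    (hξ : Dense {x : L | ∃ A ∈ Set.centralizer (Set.centralizer s), A ξ = x})
    {S T : L →L[ℂ] L} (hS : S ∈ Set.centralizer s) (hT : T ∈ Set.centralizer s)
    (hsa : IsSelfAdjoint T) : S * T = T * S := by
  have hc := Set.centralizer_centralizer_comm_of_comm hcomm
  have hstar : ∀ A ∈ Set.centralizer (Set.centralizer s),
      star A ∈ Set.centralizer (Set.centralizer s) := fun A hA =>
    star_mem_centralizer_of_star_mem (fun P hP => star_mem_centralizer_of_star_mem hs hP) hA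
  have comm : ∀ A ∈ Set.centralizer (Set.centralizer s), ∀ Q ∈ Set.centralizer s, ∀ v,
      Q (A v) = A (Q v) := fun A hA Q hQ v => congr($(hA Q hQ) v)
  obtain ⟨x, hx, hlim⟩ := mem_closure_iff_seq_limit.mp (hξ (T ξ))
  choose A hA hAx using hx
  obtain rfl : (fun n => A n ξ) = x := funext hAx
  have hlim' : Tendsto (fun n => star (A n) ξ) atTop (𝓝 (T ξ)) := by
    rw [tendsto_iff_norm_sub_tendsto_zero] at hlim ⊢
    refine hlim.congr fun n => ?_
    -- Normality gives `‖(A n - T) ξ‖ = ‖(star (A n) - T) ξ‖`, so the adjoints converge at `ξ` to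
    -- the same vector.
    have hn : IsStarNormal (A n - T) := ⟨by
      have h1 := hA n T hT
      have h2 := hstar _ (hA n) T hT
      have h3 := hc _ (hA n) _ (hstar _ (hA n))
      rw [commute_iff_eq, star_sub, hsa.star_eq]
      simp only [sub_mul, mul_sub, h1, h2, h3]
      abel⟩
    have := ContinuousLinearMap.isStarNormal_iff_norm_eq_adjoint.mp hn ξ
    rw [← ContinuousLinearMap.star_eq_adjoint, star_sub, hsa.star_eq] at this
    simpa only [sub_apply] using this
  have key : ∀ B ∈ Set.centralizer (Set.centralizer s), ∀ C ∈ Set.centralizer (Set.centralizer s),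
      ⟪C ξ, S (T (B ξ))⟫_ℂ = ⟪C ξ, T (S (B ξ))⟫_ℂ := fun B hB C hC => by
    have h1 : Tendsto (fun n => ⟪C ξ, S (B (A n ξ))⟫_ℂ) atTop (𝓝 ⟪C ξ, S (B (T ξ))⟫_ℂ) :=
      tendsto_const_nhds.inner (((S ∘L B).continuous.tendsto _).comp hlim)
    have h2 : Tendsto (fun n => ⟪C (star (A n) ξ), S (B ξ)⟫_ℂ) atTop
        (𝓝 ⟪C (T ξ), S (B ξ)⟫_ℂ) :=
      ((C.continuous.tendsto _).comp hlim').inner tendsto_const_nhds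
    have h3 : ∀ n, ⟪C ξ, S (B (A n ξ))⟫_ℂ = ⟪C (star (A n) ξ), S (B ξ)⟫_ℂ := fun n => by
      have e1 : B (A n ξ) = A n (B ξ) := congr($(hc _ hB _ (hA n)) ξ)
      have e2 : C (star (A n) ξ) = star (A n) (C ξ) := congr($(hc _ hC _ (hstar _ (hA n))) ξ)
      rw [e1, e2, comm _ (hA n) S hS, ContinuousLinearMap.star_eq_adjoint,
        ContinuousLinearMap.adjoint_inner_left]
    have h4 := tendsto_nhds_unique (h1.congr h3) h2
    rw [comm B hB T hT, h4, ← comm C hC T hT, ← ContinuousLinearMap.adjoint_inner_right,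
      ← ContinuousLinearMap.star_eq_adjoint, hsa.star_eq]
  have hvec : ∀ B ∈ Set.centralizer (Set.centralizer s), S (T (B ξ)) = T (S (B ξ)) :=
    fun B hB => hξ.eq_of_inner_right ℂ (by rintro _ ⟨C, hC, rfl⟩; exact key B hB C hC)
  refine ContinuousLinearMap.coeFn_injective
    (Continuous.ext_on hξ (S * T).continuous (T * S).continuous ?_)
  rintro _ ⟨B, hB, rfl⟩
  exact hvec B hB

/-- The commutant of a commuting self-adjoint family whose bicommutant has a cyclic vector is
commutative. -/
lemma centralizer_commute_of_cyclic {s : Set (L →L[ℂ] L)} (hs : ∀ P ∈ s, star P ∈ s)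
    (hcomm : ∀ P ∈ s, ∀ Q ∈ s, P * Q = Q * P) {ξ : L}
    (hξ : Dense {x : L | ∃ A ∈ Set.centralizer (Set.centralizer s), A ξ = x})
    {S T : L →L[ℂ] L} (hS : S ∈ Set.centralizer s) (hT : T ∈ Set.centralizer s) :
    S * T = T * S := by
  have hT' := star_mem_centralizer_of_star_mem hs hT
  have hsmul : ∀ (c : ℂ), ∀ A ∈ Set.centralizer s, c • A ∈ Set.centralizer s :=
    fun c A hA => (Subalgebra.centralizer ℂ s).smul_mem hA c
  have hre : (realPart T : L →L[ℂ] L) ∈ Set.centralizer s := by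
    rw [realPart_apply_coe, ← Complex.coe_smul]
    exact hsmul _ _ (Set.add_mem_centralizer hT hT')
  have him : (imaginaryPart T : L →L[ℂ] L) ∈ Set.centralizer s := by
    rw [imaginaryPart_apply_coe, ← Complex.coe_smul]
    exact hsmul _ _ (hsmul _ _ ((Subalgebra.centralizer ℂ s).sub_mem hT hT'))
  have h1 := centralizer_commute_of_isSelfAdjoint hs hcomm hξ hS hre (realPart T).2
  have h2 := centralizer_commute_of_isSelfAdjoint hs hcomm hξ hS him (imaginaryPart T).2
  rw [← realPart_add_I_smul_imaginaryPart T, mul_add, add_mul, h1, mul_smul_comm, smul_mul_assoc,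
    h2]

end Cyclic

/-! ### The `L²[0,1]` model and Lebesgue differentiation -/

section SpectralIndexing

variable {H : Type*} [NormedAddCommGroup H] [InnerProductSpace ℂ H] [CompleteSpace H]
  {𝒩₀ : Set (H →L[ℂ] H)} {N₀ : ℝ → H →L[ℂ] H}

lemma IsSpectralIndexing.apply_of_neg (h : IsSpectralIndexing 𝒩₀ N₀) {t : ℝ} (ht : t < 0) :
    N₀ t = 0 := by
  obtain ⟨⟨U, hU⟩, -⟩ := h
  ext f
  apply U.injective
  rw [zero_apply, map_zero]
  refine Lp.ext ((hU t f).trans ?_)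
  rw [Set.Icc_eq_empty (not_le.mpr ht), Set.indicator_empty]
  exact (Lp.coeFn_zero _ _ _).symm

lemma IsSpectralIndexing.apply_of_one_lt (h : IsSpectralIndexing 𝒩₀ N₀) {t : ℝ} (ht : 1 < t) :
    N₀ t = 1 := by
  obtain ⟨⟨U, hU⟩, -⟩ := h
  ext f
  apply U.injective
  rw [one_apply_eq_self]
  refine Lp.ext ((hU t f).trans ?_)
  filter_upwards [ae_restrict_mem measurableSet_Icc] with x hx
  exact Set.indicator_of_mem (Set.mem_Icc.mpr ⟨hx.1, hx.2.trans ht.le⟩) _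

lemma IsSpectralIndexing.isProjFamily (hnest : IsNest 𝒩₀) (h : IsSpectralIndexing 𝒩₀ N₀) :
    IsProjFamily N₀ where
  proj t := by
    rcases lt_or_ge t 0 with ht | ht
    · rw [h.apply_of_neg ht]; exact .zero _
    rcases lt_or_ge 1 t with ht' | ht'
    · rw [h.apply_of_one_lt ht']; exact .one _
    · exact hnest.isStarProjection _ (by rw [h.2]; exact ⟨t, ⟨ht, ht'⟩, rfl⟩)
  mul s t := by
    obtain ⟨⟨U, hU⟩, -⟩ := h
    ext f
    apply U.injective
    refine Lp.ext ?_
    rw [mul_apply_eq_comp]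
    filter_upwards [hU s (N₀ t f), hU t f, hU (min s t) f] with x h1 h2 h3
    rw [h1, h3]
    by_cases hx : x ∈ Set.Icc 0 s
    · rw [Set.indicator_of_mem hx, h2]
      by_cases hx' : x ∈ Set.Icc 0 t
      · rw [Set.indicator_of_mem hx', Set.indicator_of_mem (Set.mem_Icc.mpr ⟨hx.1, le_min hx.2 hx'.2⟩)]
      · rw [Set.indicator_of_notMem hx', Set.indicator_of_notMem]
        exact fun hm => hx' ⟨hm.1, hm.2.trans (min_le_right _ _)⟩
    · rw [Set.indicator_of_notMem hx, Set.indicator_of_notMem]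
      exact fun hm => hx ⟨hm.1, hm.2.trans (min_le_left _ _)⟩

/-- The spectral density of a vector on `[0,1]`. -/
def density (U : H ≃ₗᵢ[ℂ] Lp ℂ 2 (volume.restrict (Set.Icc (0 : ℝ) 1))) (h : H) : ℝ → ℝ :=
  (Set.Icc (0 : ℝ) 1).indicator fun x => ‖(U h : ℝ → ℂ) x‖ ^ 2

variable {U : H ≃ₗᵢ[ℂ] Lp ℂ 2 (volume.restrict (Set.Icc (0 : ℝ) 1))}

lemma integrable_density (h : H) : Integrable (density U h) := by
  rw [density, integrable_indicator_iff measurableSet_Icc]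
  exact (memLp_two_iff_integrable_sq_norm (Lp.aestronglyMeasurable _)).mp (Lp.memLp (U h))

lemma norm_sq_eq_integral_density (h : H) :
    ‖h‖ ^ 2 = ∫ x in Set.Icc (0 : ℝ) 1, ‖(U h : ℝ → ℂ) x‖ ^ 2 := by
  rw [← U.norm_map h]
  have h1 : ((‖U h‖ ^ 2 : ℝ) : ℂ) = ⟪U h, U h⟫_ℂ := by
    rw [inner_self_eq_norm_sq_to_K]; simp
  rw [L2.inner_def] at h1
  have h2 : (∫ x in Set.Icc (0 : ℝ) 1, ⟪(U h : ℝ → ℂ) x, (U h : ℝ → ℂ) x⟫_ℂ) =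
      ((∫ x in Set.Icc (0 : ℝ) 1, ‖(U h : ℝ → ℂ) x‖ ^ 2 : ℝ) : ℂ) := by
    rw [← integral_complex_ofReal]
    refine integral_congr_ae (ae_of_all _ fun x => ?_)
    simp only [inner_self_eq_norm_sq_to_K]
    simp
  rw [h2] at h1
  exact_mod_cast h1

/-- Turns interval norms into increments of a primitive, whose derivative recovers `density U h`
almost everywhere. -/
lemma norm_sq_interval_eq (hU : ∀ (t : ℝ) (f : H),
      (U (N₀ t f) : ℝ → ℂ) =ᵐ[volume.restrict (Set.Icc (0 : ℝ) 1)]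
        (Set.Icc (0 : ℝ) t).indicator (U f : ℝ → ℂ)) {s t : ℝ} (hst : s ≤ t) (h : H) :
    ‖(N₀ t - N₀ s) h‖ ^ 2 = ∫ x in s..t, density U h x := by
  rw [norm_sq_eq_integral_density (U := U), intervalIntegral.integral_of_le hst, density,
    ← integral_indicator measurableSet_Ioc, ← integral_indicator measurableSet_Icc]
  rw [Set.indicator_indicator, Set.inter_comm, ← Set.indicator_indicator,
    integral_indicator measurableSet_Icc, integral_indicator measurableSet_Icc]
  refine integral_congr_ae ?_
  rw [sub_apply, map_sub]
  filter_upwards [hU t h, hU s h, Lp.coeFn_sub (U (N₀ t h)) (U (N₀ s h)),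
    ae_restrict_mem measurableSet_Icc] with x h1 h2 h3 hx
  rw [h3, Pi.sub_apply, h1, h2]
  simp only [Set.indicator_apply, Set.mem_Icc, Set.mem_Ioc, hx.1, true_and]
  rcases le_or_gt x s with hs | hs
  · simp [hs, hs.trans hst, hs.not_gt]
  · by_cases ht : x ≤ t <;> simp [hs, hs.not_ge, ht]

/-- A difference of primitives that is nonnegative to the right of `x` has nonnegative
derivative there. -/
lemma nonneg_of_hasDerivAt_of_right {Ψ : ℝ → ℝ} {c x u : ℝ} (hΨ : HasDerivAt Ψ c x) (hu : x < u)
    (h : ∀ y, x < y → y < u → Ψ x ≤ Ψ y) : 0 ≤ c := by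
  have ht := (hasDerivAt_iff_tendsto_slope_left_right.mp hΨ).2
  refine ge_of_tendsto ht ?_
  filter_upwards [Ioo_mem_nhdsGT hu] with y hy
  rw [slope_def_field]
  exact div_nonneg (sub_nonneg.mpr (h y hy.1 hy.2)) (sub_nonneg.mpr hy.1.le)

/-- An operator in the commutant of the nest vanishes if its diagonal seminorm vanishes almost
everywhere. -/
lemma eq_zero_of_ae_diagSeminorm_eq_zero (hnest : IsNest 𝒩₀) (hN₀ : IsSpectralIndexing 𝒩₀ N₀)
    {Y : H →L[ℂ] H} (hY : ∀ t, N₀ t * Y = Y * N₀ t)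
    (h0 : ∀ᵐ x ∂(volume.restrict (Set.Icc (0 : ℝ) 1)), diagSeminorm N₀ x Y = 0) : Y = 0 := by
  have hN := hN₀.isProjFamily hnest
  obtain ⟨⟨U, hU⟩, -⟩ := hN₀
  ext h
  apply U.injective
  rw [zero_apply, map_zero]
  refine Lp.ext (EventuallyEq.trans ?_ (Lp.coeFn_zero _ _ _).symm)
  have d1 := ae_restrict_of_ae (s := Set.Icc (0 : ℝ) 1)
    (_root_.LocallyIntegrable.ae_hasDerivAt_integral
      (integrable_density (U := U) h).locallyIntegrable)
  have d2 := ae_restrict_of_ae (s := Set.Icc (0 : ℝ) 1)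
    (_root_.LocallyIntegrable.ae_hasDerivAt_integral
      (integrable_density (U := U) (Y h)).locallyIntegrable)
  filter_upwards [h0, d1, d2, ae_restrict_mem measurableSet_Icc] with x hx hd1 hd2 hmem
  have key : ∀ δ > 0, density U (Y h) x ≤ δ ^ 2 * density U h x := fun δ hδ => by
    obtain ⟨s, u, hs, hu, hsu⟩ := exists_interval_of_diagSeminorm_lt (hx.trans_lt hδ)
    -- Both primitives are based at `x` itself, so they vanish there and their values at `y` are the
    -- squared norms over the interval from `x` to `y`.
    have hder := ((hd1 x).const_mul (δ ^ 2)).sub (hd2 x)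
    refine sub_nonneg.mp (nonneg_of_hasDerivAt_of_right hder hu fun y hxy hyu => ?_)
    simp only [Pi.sub_apply, intervalIntegral.integral_same, mul_zero, sub_zero]
    rw [← norm_sq_interval_eq hU hxy.le, ← norm_sq_interval_eq hU hxy.le, sub_nonneg, ← mul_pow]
    have hid := (hN.interval hxy.le).isIdempotentElem.eq
    -- Commutation with the nest turns the one-sided cut-off of `Y` into a compression, to which the
    -- bound by `δ` applies.
    have e : (N₀ y - N₀ x) * Y = ((N₀ y - N₀ x) * Y * (N₀ y - N₀ x)) * (N₀ y - N₀ x) := by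
      rw [mul_assoc _ (N₀ y - N₀ x), hid, mul_assoc, mul_sub Y, ← hY, ← hY, ← sub_mul,
        ← mul_assoc, hid]
    have hle : ‖(N₀ y - N₀ x) * Y * (N₀ y - N₀ x)‖ ≤ δ :=
      (hN.norm_interval_mono hs.le hxy.le hyu.le Y).trans hsu.le
    have : ‖(N₀ y - N₀ x) (Y h)‖ ≤ δ * ‖(N₀ y - N₀ x) h‖ := by
      have e' := congr($e h)
      rw [mul_apply_eq_comp, mul_apply_eq_comp _ (N₀ y - N₀ x)] at e'
      rw [e']
      exact ContinuousLinearMap.le_of_opNorm_le _ hle _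
    gcongr
  have hz : density U (Y h) x ≤ 0 := by
    have ht : Tendsto (fun δ : ℝ => δ ^ 2 * density U h x) (𝓝[>] 0)
        (𝓝 (0 ^ 2 * density U h x)) :=
      (Continuous.tendsto (by fun_prop) 0).mono_left nhdsWithin_le_nhds
    simpa using ge_of_tendsto ht (eventually_nhdsWithin_of_forall key)
  rw [density, Set.indicator_of_mem hmem] at hz
  rw [Pi.zero_apply]
  exact norm_eq_zero.mp (pow_eq_zero_iff two_ne_zero |>.mp (le_antisymm hz (sq_nonneg _)))

end SpectralIndexing

/-! ### Limits of real sequences -/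

section Limits

/-- `limUnder` is informative only for convergent sequences; monotonicity and the lower bound supply
the convergence. -/
lemma limUnder_eq_zero_iff {f : ℕ → ℝ} (hf : Antitone f) (h0 : ∀ k, 0 ≤ f k) :
    limUnder atTop f = 0 ↔ Tendsto f atTop (𝓝 0) := by
  have ht := tendsto_atTop_ciInf hf ⟨0, by rintro _ ⟨k, rfl⟩; exact h0 k⟩
  refine ⟨fun h => ?_, fun h => h.limUnder_eq⟩
  rw [ht.limUnder_eq] at h
  rwa [h] at ht

/-- First fix the splitting index `k` to make `r k` small, then let `m` grow. -/
lemma tendsto_zero_of_forall_le {f r : ℕ → ℝ} {g : ℕ → ℕ → ℝ} (h0 : ∀ m, 0 ≤ f m)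
    (hle : ∀ k m, f m ≤ g k m + r k) (hg : ∀ k, Tendsto (g k) atTop (𝓝 0))
    (hr : Tendsto r atTop (𝓝 0)) : Tendsto f atTop (𝓝 0) := by
  refine tendsto_order.mpr ⟨fun a ha => .of_forall fun m => ha.trans_le (h0 m), fun a ha => ?_⟩
  obtain ⟨k, hk⟩ := ((tendsto_order.mp hr).2 (a / 2) (half_pos ha)).exists
  filter_upwards [(tendsto_order.mp (hg k)).2 (a / 2) (half_pos ha)] with m hm
  linarith [hle k m]

end Limits

/-! ### Invariance, reduction and adjoints -/

section StarCommute

variable {L : Type*} [NormedAddCommGroup L] [InnerProductSpace ℂ L] [CompleteSpace L]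

lemma commute_of_invariant {P X : L →L[ℂ] L} (hP : IsSelfAdjoint P) (h : P * X * P = X * P)
    (h' : P * star X * P = star X * P) : P * X = X * P := by
  have := congr_arg star h'
  rw [star_mul, star_mul, star_mul, star_star, hP.star_eq, ← mul_assoc] at this
  exact this.symm.trans h

lemma commute_star {P X : L →L[ℂ] L} (hP : IsSelfAdjoint P) (h : P * X = X * P) :
    P * star X = star X * P := by
  have := congr_arg star h
  rw [star_mul, star_mul, hP.star_eq] at this
  exact this.symm

lemma star_compress {P Q : L →L[ℂ] L} (hP : IsSelfAdjoint P) (hQ : IsSelfAdjoint Q)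
    (X : L →L[ℂ] L) : star (P * X * Q) = Q * star X * P := by
  rw [star_mul, star_mul, hP.star_eq, hQ.star_eq, mul_assoc]

end StarCommute

/-! ### Closure of `T(S, R, C)` under sums and products -/

section Amplification

variable {H K : Type*} [NormedAddCommGroup H] [InnerProductSpace ℂ H] [CompleteSpace H]
  [NormedAddCommGroup K] [InnerProductSpace ℂ K] [CompleteSpace K]
  {𝒩₀ : Set (H →L[ℂ] H)} {N₀ : ℝ → H →L[ℂ] H} (ε : HilbertBasis ℕ ℂ K)

lemma IsProjFamily.amp (hN : IsProjFamily N₀) : IsProjFamily (ampIndex (K := K) N₀) where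
  proj t := isStarProjection_tensorOp (hN.proj t) (.one _)
  mul s t := by rw [ampIndex, ampIndex, tensorOp_mul, hN.mul, one_mul, ampIndex]

lemma mem_nestAlg_ampNest_iff (hnest : IsNest 𝒩₀) (hN₀ : IsSpectralIndexing 𝒩₀ N₀)
    (X : HilbertTensor H K →L[ℂ] HilbertTensor H K) :
    X ∈ nestAlg (ampNest 𝒩₀) ↔ IsUpper (ampIndex N₀) X := by
  have hN := (hN₀.isProjFamily hnest).amp (K := K)
  constructor
  · intro h t
    rcases lt_or_ge t 0 with ht | ht
    · rw [ampIndex, hN₀.apply_of_neg ht, tensorOp_zero_left, mul_zero, mul_zero]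
    rcases lt_or_ge 1 t with ht' | ht'
    · rw [ampIndex, hN₀.apply_of_one_lt ht', tensorOp_one, one_mul]
    ext v
    refine h (ampIndex N₀ t) ⟨N₀ t, ?_, rfl⟩ (ampIndex N₀ t v) ?_
    · rw [hN₀.2]; exact ⟨t, ⟨ht, ht'⟩, rfl⟩
    · exact congr($((hN.proj t).isIdempotentElem.eq) v)
  · rintro h _ ⟨P, hP, rfl⟩ v hv
    rw [hN₀.2] at hP
    obtain ⟨t, -, rfl⟩ := hP
    have := congr($(h t) v)
    simp only [mul_apply_eq_comp, ampIndex] at this hv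
    rwa [hv] at this

lemma ampIndex_mul_blockProj (t : ℝ) (i : ℕ) :
    ampIndex N₀ t * blockProj ε i = blockProj ε i * ampIndex N₀ t := by
  rw [ampIndex, blockProj, tensorOp_mul, tensorOp_mul, one_mul, mul_one, one_mul, mul_one]

lemma ampIndex_mul_tailProj (t : ℝ) (k : ℕ) :
    ampIndex N₀ t * tailProj ε k = tailProj ε k * ampIndex N₀ t := by
  rw [tailProj, mul_sub, sub_mul, mul_one, one_mul, Finset.mul_sum, Finset.sum_mul]
  simp only [ampIndex_mul_blockProj]

lemma isUpper_blockProj (hN : IsProjFamily N₀) (i : ℕ) : IsUpper (ampIndex N₀) (blockProj ε i) :=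
  .of_commute hN.amp fun t => ampIndex_mul_blockProj ε t i

lemma isUpper_tailProj (hN : IsProjFamily N₀) (k : ℕ) : IsUpper (ampIndex N₀) (tailProj ε k) :=
  .of_commute hN.amp fun t => ampIndex_mul_tailProj ε t k

lemma diagSeminorm_tailProj_le (hN : IsProjFamily N₀) (t : ℝ) (k : ℕ) :
    diagSeminorm (ampIndex N₀) t (tailProj ε k) ≤ 1 :=
  (diagSeminorm_le_norm hN.amp t _).trans (isStarProjection_tailProj ε k).norm_le

variable {X Y : HilbertTensor H K →L[ℂ] HilbertTensor H K}

/-- A later tail is the earlier one times a further projection of seminorm at most one;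
submultiplicativity needs `X` in the nest algebra. -/
lemma antitone_row (hN : IsProjFamily N₀) (hX : IsUpper (ampIndex N₀) X) (i : ℕ) (t : ℝ) :
    Antitone fun k => diagSeminorm (ampIndex N₀) t (blockProj ε i * X * tailProj ε k) := by
  intro k l hkl
  have e : blockProj ε i * X * tailProj ε l = blockProj ε i * X * tailProj ε k * tailProj ε l := by
    rw [mul_assoc _ (tailProj ε k), tailProj_mul ε hkl]
  dsimp only
  rw [e]
  refine (diagSeminorm_mul_le hN.amp t (((isUpper_blockProj ε hN i).mul hX).mul
    (isUpper_tailProj ε hN k)) (isUpper_tailProj ε hN l)).trans ?_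
  exact mul_le_of_le_one_right (diagSeminorm_nonneg _ _) (diagSeminorm_tailProj_le ε hN t l)

lemma antitone_col (hN : IsProjFamily N₀) (hX : IsUpper (ampIndex N₀) X) (j : ℕ) (t : ℝ) :
    Antitone fun k => diagSeminorm (ampIndex N₀) t (tailProj ε k * X * blockProj ε j) := by
  intro k l hkl
  have e : tailProj ε l * X * blockProj ε j =
      tailProj ε l * (tailProj ε k * X * blockProj ε j) := by
    rw [← mul_assoc, ← mul_assoc, tailProj_mul' ε hkl]
  dsimp only
  rw [e]
  refine (diagSeminorm_mul_le hN.amp t (isUpper_tailProj ε hN l) (((isUpper_tailProj ε hN k).mul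
    hX).mul (isUpper_blockProj ε hN j))).trans ?_
  exact mul_le_of_le_one_left (diagSeminorm_nonneg _ _) (diagSeminorm_tailProj_le ε hN t l)

lemma mem_TSRC_iff (hnest : IsNest 𝒩₀) (hN₀ : IsSpectralIndexing 𝒩₀ N₀)
    (S : ℕ → ℕ → Set ℝ) (R C : ℕ → Set ℝ) :
    X ∈ TSRC 𝒩₀ N₀ ε S R C ↔ IsUpper (ampIndex N₀) X ∧
      (∀ i j, ∀ᵐ t ∂(volume.restrict (Set.Icc (0 : ℝ) 1)), t ∉ S i j →
        diagSeminorm (ampIndex N₀) t (blockProj ε i * X * blockProj ε j) = 0) ∧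
      (∀ i, ∀ᵐ t ∂(volume.restrict (Set.Icc (0 : ℝ) 1)), t ∉ R i →
        Tendsto (fun k => diagSeminorm (ampIndex N₀) t (blockProj ε i * X * tailProj ε k)) atTop
          (𝓝 0)) ∧
      (∀ j, ∀ᵐ t ∂(volume.restrict (Set.Icc (0 : ℝ) 1)), t ∉ C j →
        Tendsto (fun k => diagSeminorm (ampIndex N₀) t (tailProj ε k * X * blockProj ε j)) atTop
          (𝓝 0)) := by
  have hN := hN₀.isProjFamily hnest
  have hmem : X ∈ TSRC 𝒩₀ N₀ ε S R C ↔ X ∈ nestAlg (ampNest 𝒩₀) ∧ _ := Iff.rfl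
  rw [hmem, mem_nestAlg_ampNest_iff hnest hN₀]
  refine and_congr_right fun hX => and_congr_right fun _ => ?_
  simp only [rowSeminorm, colSeminorm,
    fun i t => limUnder_eq_zero_iff (antitone_row ε hN hX i t) fun _ => diagSeminorm_nonneg _ _,
    fun j t => limUnder_eq_zero_iff (antitone_col ε hN hX j t) fun _ => diagSeminorm_nonneg _ _]

/-- Submultiplicativity along the decomposition into the first `k` blocks and the tail. -/
lemma diagSeminorm_mul_le_sum (hN : IsProjFamily N₀) (t : ℝ) (k : ℕ)
    (hX : IsUpper (ampIndex N₀) X) (hY : IsUpper (ampIndex N₀) Y) :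
    diagSeminorm (ampIndex N₀) t (X * Y) ≤
      ∑ l ∈ Finset.range k, diagSeminorm (ampIndex N₀) t (X * blockProj ε l) *
        diagSeminorm (ampIndex N₀) t (blockProj ε l * Y) +
      diagSeminorm (ampIndex N₀) t (X * tailProj ε k) *
        diagSeminorm (ampIndex N₀) t (tailProj ε k * Y) := by
  have e : X * Y = ∑ l ∈ Finset.range k, (X * blockProj ε l) * (blockProj ε l * Y) +
      (X * tailProj ε k) * (tailProj ε k * Y) := by
    have h1 : ∀ l, (X * blockProj ε l) * (blockProj ε l * Y) = X * blockProj ε l * Y := fun l => by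
      rw [mul_assoc, ← mul_assoc (blockProj ε l),
        (isStarProjection_blockProj ε l).isIdempotentElem.eq, ← mul_assoc]
    have h2 : (X * tailProj ε k) * (tailProj ε k * Y) = X * tailProj ε k * Y := by
      rw [mul_assoc, ← mul_assoc (tailProj ε k),
        (isStarProjection_tailProj ε k).isIdempotentElem.eq, ← mul_assoc]
    simp only [h1, h2]
    rw [← Finset.sum_mul, ← Finset.mul_sum, ← add_mul, ← mul_add, sum_blockProj_add_tailProj,
      mul_one]
  conv_lhs => rw [e]
  refine (diagSeminorm_add_le hN.amp t _ _).trans (add_le_add ?_ ?_)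
  · refine (diagSeminorm_sum_le hN.amp t _ _).trans (Finset.sum_le_sum fun l _ => ?_)
    exact diagSeminorm_mul_le hN.amp t (hX.mul (isUpper_blockProj ε hN l))
      ((isUpper_blockProj ε hN l).mul hY)
  · exact diagSeminorm_mul_le hN.amp t (hX.mul (isUpper_tailProj ε hN k))
      ((isUpper_tailProj ε hN k).mul hY)

/-- All terms through single blocks vanish, leaving the row tail of `X` times the column tail of
`Y`. One of these tends to zero while the other stays bounded. -/
lemma diagSeminorm_block_mul_eq_zero (hN : IsProjFamily N₀) {t : ℝ} {i j : ℕ}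
    (hX : IsUpper (ampIndex N₀) X) (hY : IsUpper (ampIndex N₀) Y)
    (h : ∀ l, diagSeminorm (ampIndex N₀) t (blockProj ε i * X * blockProj ε l) = 0 ∨
      diagSeminorm (ampIndex N₀) t (blockProj ε l * Y * blockProj ε j) = 0)
    (h' : Tendsto (fun k => diagSeminorm (ampIndex N₀) t (blockProj ε i * X * tailProj ε k))
        atTop (𝓝 0) ∨
      Tendsto (fun k => diagSeminorm (ampIndex N₀) t (tailProj ε k * Y * blockProj ε j))
        atTop (𝓝 0)) :
    diagSeminorm (ampIndex N₀) t (blockProj ε i * (X * Y) * blockProj ε j) = 0 := by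
  have hle : ∀ k, diagSeminorm (ampIndex N₀) t (blockProj ε i * (X * Y) * blockProj ε j) ≤
      diagSeminorm (ampIndex N₀) t (blockProj ε i * X * tailProj ε k) *
        diagSeminorm (ampIndex N₀) t (tailProj ε k * Y * blockProj ε j) := fun k => by
    have := diagSeminorm_mul_le_sum ε hN t k ((isUpper_blockProj ε hN i).mul hX)
      (hY.mul (isUpper_blockProj ε hN j))
    rw [Finset.sum_eq_zero, zero_add] at this
    · simpa only [mul_assoc] using this
    · intro l _
      rw [← mul_assoc (blockProj ε l) Y]
      rcases h l with h | h <;> simp only [h, zero_mul, mul_zero]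
  refine le_antisymm ?_ (diagSeminorm_nonneg _ _)
  have nonneg := fun Z => diagSeminorm_nonneg (N := ampIndex (K := K) N₀) t Z
  rcases h' with h' | h'
  · refine ge_of_tendsto (by simpa using h'.mul_const ‖Y * blockProj ε j‖) (.of_forall fun k => ?_)
    refine (hle k).trans (mul_le_mul_of_nonneg_left ?_ (nonneg _))
    rw [mul_assoc]
    refine (diagSeminorm_mul_le hN.amp t (isUpper_tailProj ε hN k)
      (hY.mul (isUpper_blockProj ε hN j))).trans ?_
    exact (mul_le_of_le_one_left (nonneg _) (diagSeminorm_tailProj_le ε hN t k)).trans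
      (diagSeminorm_le_norm hN.amp t _)
  · refine ge_of_tendsto (by simpa using h'.const_mul ‖blockProj ε i * X‖) (.of_forall fun k => ?_)
    refine (hle k).trans (mul_le_mul_of_nonneg_right ?_ (nonneg _))
    refine (diagSeminorm_mul_le hN.amp t ((isUpper_blockProj ε hN i).mul hX)
      (isUpper_tailProj ε hN k)).trans ?_
    exact (mul_le_of_le_one_right (nonneg _) (diagSeminorm_tailProj_le ε hN t k)).trans
      (diagSeminorm_le_norm hN.amp t _)

lemma diagSeminorm_tail_mul_tail_le (hN : IsProjFamily N₀) (t : ℝ) (k m : ℕ)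
    (hY : IsUpper (ampIndex N₀) Y) :
    diagSeminorm (ampIndex N₀) t (tailProj ε k * Y * tailProj ε m) ≤ ‖Y‖ := by
  have nonneg := fun Z => diagSeminorm_nonneg (N := ampIndex (K := K) N₀) t Z
  refine (diagSeminorm_mul_le hN.amp t ((isUpper_tailProj ε hN k).mul hY)
    (isUpper_tailProj ε hN m)).trans ?_
  refine (mul_le_of_le_one_right (nonneg _) (diagSeminorm_tailProj_le ε hN t m)).trans ?_
  refine (diagSeminorm_mul_le hN.amp t (isUpper_tailProj ε hN k) hY).trans ?_
  exact (mul_le_of_le_one_left (nonneg _) (diagSeminorm_tailProj_le ε hN t k)).trans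
    (diagSeminorm_le_norm hN.amp t _)

/-- Two indices are at play: the product is split at `k`, and `m` is the tail of the product. For
fixed `k` the finite sum tends to zero in `m`; the remainder is at most the row tail of `X` at `k`
times `‖Y‖`, uniformly in `m`. -/
lemma tendsto_row_mul (hN : IsProjFamily N₀) {t : ℝ} {i : ℕ}
    (hX : IsUpper (ampIndex N₀) X) (hY : IsUpper (ampIndex N₀) Y)
    (h : ∀ l, diagSeminorm (ampIndex N₀) t (blockProj ε i * X * blockProj ε l) = 0 ∨
      Tendsto (fun k => diagSeminorm (ampIndex N₀) t (blockProj ε l * Y * tailProj ε k))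
        atTop (𝓝 0))
    (h' : Tendsto (fun k => diagSeminorm (ampIndex N₀) t (blockProj ε i * X * tailProj ε k))
        atTop (𝓝 0)) :
    Tendsto (fun k => diagSeminorm (ampIndex N₀) t (blockProj ε i * (X * Y) * tailProj ε k))
      atTop (𝓝 0) := by
  have hg : ∀ k, Tendsto (fun m => ∑ l ∈ Finset.range k,
      diagSeminorm (ampIndex N₀) t (blockProj ε i * X * blockProj ε l) *
        diagSeminorm (ampIndex N₀) t (blockProj ε l * Y * tailProj ε m)) atTop (𝓝 0) := fun k => by
    rw [← Finset.sum_const_zero (s := Finset.range k)]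
    refine tendsto_finsetSum _ fun l _ => ?_
    rcases h l with h | h
    · simp only [h, zero_mul]; exact tendsto_const_nhds
    · simpa using h.const_mul (diagSeminorm (ampIndex N₀) t (blockProj ε i * X * blockProj ε l))
  refine tendsto_zero_of_forall_le (fun _ => diagSeminorm_nonneg _ _) (fun k m => ?_) hg
    (by simpa using h'.mul_const ‖Y‖)
  have := diagSeminorm_mul_le_sum ε hN t k ((isUpper_blockProj ε hN i).mul hX)
    (hY.mul (isUpper_tailProj ε hN m))
  simp only [← mul_assoc] at this ⊢
  exact this.trans (by gcongr; exacts [diagSeminorm_nonneg _ _,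
    diagSeminorm_tail_mul_tail_le ε hN t k m hY])

lemma tendsto_col_mul (hN : IsProjFamily N₀) {t : ℝ} {j : ℕ}
    (hX : IsUpper (ampIndex N₀) X) (hY : IsUpper (ampIndex N₀) Y)
    (h : ∀ l, Tendsto (fun k => diagSeminorm (ampIndex N₀) t (tailProj ε k * X * blockProj ε l))
        atTop (𝓝 0) ∨ diagSeminorm (ampIndex N₀) t (blockProj ε l * Y * blockProj ε j) = 0)
    (h' : Tendsto (fun k => diagSeminorm (ampIndex N₀) t (tailProj ε k * Y * blockProj ε j))
        atTop (𝓝 0)) :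
    Tendsto (fun k => diagSeminorm (ampIndex N₀) t (tailProj ε k * (X * Y) * blockProj ε j))
      atTop (𝓝 0) := by
  have hg : ∀ k, Tendsto (fun m => ∑ l ∈ Finset.range k,
      diagSeminorm (ampIndex N₀) t (tailProj ε m * X * blockProj ε l) *
        diagSeminorm (ampIndex N₀) t (blockProj ε l * Y * blockProj ε j)) atTop (𝓝 0) :=
      fun k => by
    rw [← Finset.sum_const_zero (s := Finset.range k)]
    refine tendsto_finsetSum _ fun l _ => ?_
    rcases h l with h | h
    · simpa using h.mul_const (diagSeminorm (ampIndex N₀) t (blockProj ε l * Y * blockProj ε j))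
    · simp only [h, mul_zero]; exact tendsto_const_nhds
  refine tendsto_zero_of_forall_le (fun _ => diagSeminorm_nonneg _ _) (fun k m => ?_) hg
    (by simpa using h'.const_mul ‖X‖)
  have := diagSeminorm_mul_le_sum ε hN t k ((isUpper_tailProj ε hN m).mul hX)
    (hY.mul (isUpper_blockProj ε hN j))
  simp only [← mul_assoc] at this ⊢
  exact this.trans (by gcongr; exacts [diagSeminorm_nonneg _ _,
    diagSeminorm_tail_mul_tail_le ε hN t m k hX])

lemma mul_mem_TSRC (hnest : IsNest 𝒩₀) (hN₀ : IsSpectralIndexing 𝒩₀ N₀)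
    {S : ℕ → ℕ → Set ℝ} {R C : ℕ → Set ℝ} (hSRC : IsExtendedTriangularSystem S R C)
    (hX : X ∈ TSRC 𝒩₀ N₀ ε S R C) (hY : Y ∈ TSRC 𝒩₀ N₀ ε S R C) :
    X * Y ∈ TSRC 𝒩₀ N₀ ε S R C := by
  have hN := hN₀.isProjFamily hnest
  rw [mem_TSRC_iff ε hnest hN₀] at hX hY ⊢
  obtain ⟨uX, sX, rX, cX⟩ := hX
  obtain ⟨uY, sY, rY, cY⟩ := hY
  refine ⟨uX.mul uY, fun i j => ?_, fun i => ?_, fun j => ?_⟩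
  -- The intermediate index `l` runs over a countable set, so a single null set serves for all `l`.
  · filter_upwards [ae_all_iff.mpr (sX i), ae_all_iff.mpr fun l => sY l j, rX i, cY j]
      with t h1 h2 h3 h4 ht
    refine diagSeminorm_block_mul_eq_zero ε hN uX uY (fun l => ?_) ?_
    · by_cases hl : t ∈ S i l
      · exact Or.inr (h2 l fun hl' => ht (hSRC.trans i l j ⟨hl, hl'⟩))
      · exact Or.inl (h1 l hl)
    · by_cases hi : t ∈ R i
      · exact Or.inr (h4 fun hj => ht (hSRC.row_col i j ⟨hi, hj⟩))
      · exact Or.inl (h3 hi)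
  · filter_upwards [ae_all_iff.mpr (sX i), ae_all_iff.mpr rY, rX i] with t h1 h2 h3 ht
    refine tendsto_row_mul ε hN uX uY (fun l => ?_) (h3 ht)
    by_cases hl : t ∈ S i l
    · exact Or.inr (h2 l fun hl' => ht (hSRC.row i l ⟨hl, hl'⟩))
    · exact Or.inl (h1 l hl)
  · filter_upwards [ae_all_iff.mpr fun l => sY l j, ae_all_iff.mpr cX, cY j] with t h1 h2 h3 ht
    refine tendsto_col_mul ε hN uX uY (fun l => ?_) (h3 ht)
    by_cases hl : t ∈ S l j
    · exact Or.inl (h2 l fun hl' => ht (hSRC.col l j ⟨hl', hl⟩))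
    · exact Or.inr (h1 l hl)

lemma add_mem_TSRC (hnest : IsNest 𝒩₀) (hN₀ : IsSpectralIndexing 𝒩₀ N₀)
    {S : ℕ → ℕ → Set ℝ} {R C : ℕ → Set ℝ}
    (hX : X ∈ TSRC 𝒩₀ N₀ ε S R C) (hY : Y ∈ TSRC 𝒩₀ N₀ ε S R C) :
    X + Y ∈ TSRC 𝒩₀ N₀ ε S R C := by
  have hN := (hN₀.isProjFamily hnest).amp (K := K)
  rw [mem_TSRC_iff ε hnest hN₀] at hX hY ⊢
  obtain ⟨uX, sX, rX, cX⟩ := hX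
  obtain ⟨uY, sY, rY, cY⟩ := hY
  have hle : ∀ (t : ℝ) (P Q : HilbertTensor H K →L[ℂ] HilbertTensor H K),
      diagSeminorm (ampIndex N₀) t (P * (X + Y) * Q) ≤
        diagSeminorm (ampIndex N₀) t (P * X * Q) + diagSeminorm (ampIndex N₀) t (P * Y * Q) :=
    fun t P Q => by
      rw [mul_add, add_mul]
      exact diagSeminorm_add_le hN t _ _
  refine ⟨uX.add uY, fun i j => ?_, fun i => ?_, fun j => ?_⟩
  · filter_upwards [sX i j, sY i j] with t h1 h2 ht
    refine le_antisymm ((hle t _ _).trans ?_) (diagSeminorm_nonneg _ _)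
    rw [h1 ht, h2 ht, add_zero]
  · filter_upwards [rX i, rY i] with t h1 h2 ht
    exact squeeze_zero (fun _ => diagSeminorm_nonneg _ _) (fun _ => hle t _ _)
      (by simpa using (h1 ht).add (h2 ht))
  · filter_upwards [cX j, cY j] with t h1 h2 ht
    exact squeeze_zero (fun _ => diagSeminorm_nonneg _ _) (fun _ => hle t _ _)
      (by simpa using (h1 ht).add (h2 ht))

end Amplification

/-! ### The diagonal as a commutant and as a tensor product -/

section Diagonal

variable {H K : Type*} [NormedAddCommGroup H] [InnerProductSpace ℂ H] [CompleteSpace H]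
  [NormedAddCommGroup K] [InnerProductSpace ℂ K] [CompleteSpace K]
  {𝒩₀ : Set (H →L[ℂ] H)} {N₀ : ℝ → H →L[ℂ] H} (ε : HilbertBasis ℕ ℂ K)
  {X Y : HilbertTensor H K →L[ℂ] HilbertTensor H K}

/-- `X` commutes with the nest projections and with the block projections. -/
def IsDiagonal (N₀ : ℝ → H →L[ℂ] H) (ε : HilbertBasis ℕ ℂ K)
    (X : HilbertTensor H K →L[ℂ] HilbertTensor H K) : Prop :=
  (∀ t, ampIndex N₀ t * X = X * ampIndex N₀ t) ∧ ∀ i, blockProj ε i * X = X * blockProj ε i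

variable {ε}

lemma IsDiagonal.star (hN : IsProjFamily N₀) (hX : IsDiagonal N₀ ε X) :
    IsDiagonal N₀ ε (star X) :=
  ⟨fun t => commute_star (hN.amp.proj t).isSelfAdjoint (hX.1 t),
    fun i => commute_star (isStarProjection_blockProj ε i).isSelfAdjoint (hX.2 i)⟩

/-- Off-diagonal blocks vanish, and row and column tails vanish for large `k`, whatever `R` and `C`
are. On the diagonal, `S i i = [0,1]` leaves nothing to check. -/
lemma IsDiagonal.mem_TSRC (hnest : IsNest 𝒩₀) (hN₀ : IsSpectralIndexing 𝒩₀ N₀)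
    {S : ℕ → ℕ → Set ℝ} {R C : ℕ → Set ℝ} (hSRC : IsExtendedTriangularSystem S R C)
    (hX : IsDiagonal N₀ ε X) : X ∈ TSRC 𝒩₀ N₀ ε S R C := by
  have hN := hN₀.isProjFamily hnest
  rw [mem_TSRC_iff ε hnest hN₀]
  refine ⟨.of_commute hN.amp hX.1, fun i j => ?_, fun i => ?_, fun j => ?_⟩
  · rcases eq_or_ne i j with rfl | hij
    · filter_upwards [ae_restrict_mem measurableSet_Icc] with t ht hS
      exact absurd (hSRC.refl i ▸ ht) hS
    · refine .of_forall fun t _ => ?_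
      rw [hX.2, mul_assoc, blockProj_mul_of_ne ε hij, mul_zero, diagSeminorm_zero]
  · refine .of_forall fun t _ => tendsto_const_nhds.congr' ?_
    filter_upwards [eventually_gt_atTop i] with k hk
    rw [hX.2, mul_assoc, blockProj_mul_tailProj ε hk, mul_zero, diagSeminorm_zero]
  · refine .of_forall fun t _ => tendsto_const_nhds.congr' ?_
    filter_upwards [eventually_gt_atTop j] with k hk
    rw [mul_assoc, ← hX.2, ← mul_assoc, tailProj_mul_blockProj ε hk, zero_mul, diagSeminorm_zero]

variable (ε) in
lemma eq_zero_of_blockProj_apply {v : HilbertTensor H K} (h : ∀ i, blockProj ε i v = 0) :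
    v = 0 := by
  have : innerSL ℂ v = 0 := ext_basis ε fun i x => by
    rw [innerSL_apply_apply, zero_apply]
    have e := congr($(blockProj_comp_tensorRight (H := H) ε i) x)
    rw [ContinuousLinearMap.comp_apply] at e
    rw [← e, ← ContinuousLinearMap.adjoint_inner_left, ← ContinuousLinearMap.star_eq_adjoint,
      (isStarProjection_blockProj ε i).isSelfAdjoint.star_eq, h, inner_zero_left]
  rw [← inner_self_eq_zero (𝕜 := ℂ), ← innerSL_apply_apply, this, zero_apply]

lemma ampIndex_sub (s t : ℝ) :
    ampIndex (K := K) N₀ t - ampIndex N₀ s = tensorOp (N₀ t - N₀ s) 1 :=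
  ext_tensorRight fun y x => by
    simp only [ampIndex, sub_apply, tensorOp_tensorRight, map_sub]

variable (ε) in
-- Passes the a.e. vanishing from the tensor product to `H`, where the differentiation argument
-- lives.
lemma diagSeminorm_block_le (i j : ℕ) (x : ℝ) :
    diagSeminorm N₀ x (block ε i j X) ≤
      diagSeminorm (ampIndex N₀) x (blockProj ε i * X * blockProj ε j) := by
  refine le_csInf ⟨_, x - 1, x + 1, by linarith, by linarith, rfl⟩ ?_
  rintro _ ⟨s, t, hs, ht, rfl⟩
  refine (diagSeminorm_le hs ht _).trans ?_
  rw [ampIndex_sub, ← block_blockProj ε i j X, ← block_tensorOp]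
  exact norm_block_le ε i j _

variable (ε) in
lemma block_commute (i j : ℕ) {F : H →L[ℂ] H} (h : tensorOp F 1 * X = X * tensorOp F 1) :
    F * block ε i j X = block ε i j X * F := by
  have h1 := block_tensorOp ε i j F 1 X
  have h2 := block_tensorOp ε i j 1 F X
  rw [tensorOp_one, mul_one, mul_one] at h1
  rw [tensorOp_one, one_mul, one_mul] at h2
  rw [← h1, ← h2, h]

lemma blockProj_mul_mul_blockProj_eq_zero (hnest : IsNest 𝒩₀) (hN₀ : IsSpectralIndexing 𝒩₀ N₀)
    {S : ℕ → ℕ → Set ℝ} {R C : ℕ → Set ℝ} (hSRC : IsExtendedTriangularSystem S R C)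
    (hX : X ∈ TSRC 𝒩₀ N₀ ε S R C) (hX' : star X ∈ TSRC 𝒩₀ N₀ ε S R C)
    (hc : ∀ t, ampIndex N₀ t * X = X * ampIndex N₀ t) {i j : ℕ} (hij : i ≠ j) :
    blockProj ε i * X * blockProj ε j = 0 := by
  have hN := hN₀.isProjFamily hnest
  rw [mem_TSRC_iff ε hnest hN₀] at hX hX'
  have h0 : block ε i j X = 0 := by
    refine eq_zero_of_ae_diagSeminorm_eq_zero hnest hN₀ (fun t => block_commute ε i j (hc t)) ?_
    filter_upwards [hX.2.1 i j, hX'.2.1 j i] with t h1 h2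
    refine le_antisymm ((diagSeminorm_block_le ε i j t).trans_eq ?_) (diagSeminorm_nonneg _ _)
    -- If `t ∈ S i j`, then `t ∉ S j i`, and the condition on the `(j, i)` block of `star X` applies
    -- after taking adjoints.
    by_cases ht : t ∈ S i j
    · rw [← diagSeminorm_star hN.amp, star_compress
        (isStarProjection_blockProj ε i).isSelfAdjoint (isStarProjection_blockProj ε j).isSelfAdjoint]
      refine h2 fun ht' => ?_
      have : t ∈ S i j ∩ S j i := ⟨ht, ht'⟩
      rw [hSRC.antisymm i j hij] at this
      exact this
    · exact h1 ht
  rw [blockProj_mul_mul_blockProj, h0, ContinuousLinearMap.zero_comp,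
    ContinuousLinearMap.comp_zero]

lemma blockProj_invariant (h : ∀ i j, i ≠ j → blockProj ε i * X * blockProj ε j = 0) (j : ℕ) :
    blockProj ε j * X * blockProj ε j = X * blockProj ε j := by
  rw [← sub_eq_zero]
  ext v
  refine eq_zero_of_blockProj_apply ε fun i => ?_
  have e : blockProj ε i * (blockProj ε j * X * blockProj ε j - X * blockProj ε j) = 0 := by
    rw [mul_sub, ← mul_assoc, ← mul_assoc, ← mul_assoc]
    rcases eq_or_ne i j with rfl | hij
    · rw [(isStarProjection_blockProj ε i).isIdempotentElem.eq, sub_self]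
    · rw [blockProj_mul_of_ne ε hij, zero_mul, zero_mul, h i j hij, sub_zero]
  exact congr($e v)

/-- The diagonal of `T(S, R, C)` is the commutant of the nest and the block projections. -/
lemma mem_TSRC_and_star_mem_iff (hnest : IsNest 𝒩₀) (hN₀ : IsSpectralIndexing 𝒩₀ N₀)
    {S : ℕ → ℕ → Set ℝ} {R C : ℕ → Set ℝ} (hSRC : IsExtendedTriangularSystem S R C) :
    (X ∈ TSRC 𝒩₀ N₀ ε S R C ∧ star X ∈ TSRC 𝒩₀ N₀ ε S R C) ↔ IsDiagonal N₀ ε X := by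
  have hN := hN₀.isProjFamily hnest
  refine ⟨fun ⟨h, h'⟩ => ?_, fun h => ⟨h.mem_TSRC hnest hN₀ hSRC,
    (h.star hN).mem_TSRC hnest hN₀ hSRC⟩⟩
  have uX := ((mem_TSRC_iff ε hnest hN₀ S R C).mp h).1
  have uX' := ((mem_TSRC_iff ε hnest hN₀ S R C).mp h').1
  have hc : ∀ t, ampIndex N₀ t * X = X * ampIndex N₀ t := fun t =>
    commute_of_invariant (hN.amp.proj t).isSelfAdjoint (uX t) (uX' t)
  have hc' : ∀ t, ampIndex N₀ t * star X = star X * ampIndex N₀ t := fun t =>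
    commute_star (hN.amp.proj t).isSelfAdjoint (hc t)
  have h'' : star (star X) ∈ TSRC 𝒩₀ N₀ ε S R C := by
    have e : star (star X) = X := star_star X
    rwa [e]
  refine ⟨hc, fun i => commute_of_invariant (isStarProjection_blockProj ε i).isSelfAdjoint
    (blockProj_invariant (fun i j hij =>
      blockProj_mul_mul_blockProj_eq_zero hnest hN₀ hSRC h h' hc hij) i)
    (blockProj_invariant (fun i j hij =>
      blockProj_mul_mul_blockProj_eq_zero hnest hN₀ hSRC h' h'' hc' hij) i)⟩

lemma IsDiagonal.mul_blockProj (hX : IsDiagonal N₀ ε X) (i : ℕ) :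
    X * blockProj ε i =
      tensorOp (block ε i i X) (InnerProductSpace.rankOne ℂ (ε i) (ε i)) := by
  rw [tensorOp_rankOne_eq, ← blockProj_mul_mul_blockProj, hX.2, mul_assoc,
    (isStarProjection_blockProj ε i).isIdempotentElem.eq]

lemma IsDiagonal.block_mem (hN₀ : IsSpectralIndexing 𝒩₀ N₀) (hX : IsDiagonal N₀ ε X) (i j : ℕ) :
    block ε i j X ∈ Set.centralizer 𝒩₀ := by
  intro P hP
  rw [hN₀.2] at hP
  obtain ⟨t, -, rfl⟩ := hP
  exact block_commute ε i j (hX.1 t)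

variable (ε) in
lemma ext_mul_blockProj (h : ∀ i, X * blockProj ε i = Y * blockProj ε i) : X = Y :=
  ext_basis ε fun i x => by
    have e := congr($(h i) (tensorRight (ε i) x))
    rwa [mul_apply_eq_comp, mul_apply_eq_comp, blockProj_tensorRight, if_pos rfl] at e

/-- On block `i` the product is the product of the diagonal blocks, which lie in the abelian
commutant of `𝒩₀`. -/
lemma IsDiagonal.commute (hN₀ : IsSpectralIndexing 𝒩₀ N₀)
    (hcomm : ∀ A ∈ Set.centralizer 𝒩₀, ∀ B ∈ Set.centralizer 𝒩₀, A * B = B * A)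
    (hX : IsDiagonal N₀ ε X) (hY : IsDiagonal N₀ ε Y) : X * Y = Y * X := by
  refine ext_mul_blockProj ε fun i => ?_
  have key : ∀ Z W : HilbertTensor H K →L[ℂ] HilbertTensor H K, IsDiagonal N₀ ε Z →
      IsDiagonal N₀ ε W → Z * W * blockProj ε i = tensorOp (block ε i i Z * block ε i i W)
        (InnerProductSpace.rankOne ℂ (ε i) (ε i)) := fun Z W hZ hW => by
    have e : Z * W * blockProj ε i = (Z * blockProj ε i) * (W * blockProj ε i) := by
      rw [← hW.2, mul_assoc Z (blockProj ε i), ← mul_assoc (blockProj ε i) (blockProj ε i),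
        (isStarProjection_blockProj ε i).isIdempotentElem.eq, hW.2, mul_assoc]
    rw [e, hZ.mul_blockProj, hW.mul_blockProj, tensorOp_mul,
      (InnerProductSpace.isStarProjection_rankOne_self (ε.orthonormal.1 i)).isIdempotentElem.eq]
  rw [key X Y hX hY, key Y X hY hX, hcomm _ (hX.block_mem hN₀ i i) _ (hY.block_mem hN₀ i i)]

/-- Each `X E_i` of a diagonal `X` is itself a generator `A ⊗ B`, so whatever commutes with the
generators commutes with `X` block by block. Conversely all `N_t` and `E_i` commute with the
generators, so the double commutant commutes with them. -/
lemma isDiagonal_iff_mem_vnTensor (hnest : IsNest 𝒩₀) (hN₀ : IsSpectralIndexing 𝒩₀ N₀)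
    {D₀ : StarSubalgebra ℂ (K →L[ℂ] K)} (hD₀ : IsMasa D₀)
    (hε : ∀ i, InnerProductSpace.rankOne ℂ (ε i) (ε i) ∈ D₀) :
    IsDiagonal N₀ ε X ↔ X ∈ vnTensor (Set.centralizer 𝒩₀) (D₀ : Set (K →L[ℂ] K)) := by
  have hN := hN₀.isProjFamily hnest
  constructor
  · intro hX Z hZ
    have hZ' : ∀ A ∈ Set.centralizer 𝒩₀, ∀ B ∈ D₀, tensorOp A B * Z = Z * tensorOp A B :=
      fun A hA B hB => hZ _ ⟨A, hA, B, hB, rfl⟩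
    have hZE : ∀ i, blockProj ε i * Z = Z * blockProj ε i := fun i =>
      hZ' 1 (Set.one_mem_centralizer) _ (hε i)
    refine ext_mul_blockProj ε fun i => ?_
    rw [mul_assoc, hX.mul_blockProj, ← hZ' _ (hX.block_mem hN₀ i i) _ (hε i), ← hX.mul_blockProj,
      mul_assoc, hZE, mul_assoc]
  · intro hX
    refine ⟨fun t => hX _ ?_, fun i => hX _ ?_⟩
    · rintro _ ⟨A, hA, B, hB, rfl⟩
      have hAt : A * N₀ t = N₀ t * A := by
        rcases lt_or_ge t 0 with ht | ht
        · rw [hN₀.apply_of_neg ht, mul_zero, zero_mul]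
        rcases lt_or_ge 1 t with ht' | ht'
        · rw [hN₀.apply_of_one_lt ht', mul_one, one_mul]
        · exact (hA _ (by rw [hN₀.2]; exact ⟨t, ⟨ht, ht'⟩, rfl⟩)).symm
      rw [ampIndex, tensorOp_mul, tensorOp_mul, hAt, mul_one, one_mul]
    · rintro _ ⟨A, hA, B, hB, rfl⟩
      rw [blockProj, tensorOp_mul, tensorOp_mul, mul_one, one_mul, hD₀.1 B hB _ (hε i)]

lemma IsDiagonal.algebraMap (c : ℂ) :
    IsDiagonal N₀ ε (algebraMap ℂ (HilbertTensor H K →L[ℂ] HilbertTensor H K) c) :=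
  ⟨fun _ => (Algebra.commutes c _).symm, fun _ => (Algebra.commutes c _).symm⟩

lemma isDiagonal_ampIndex (hN : IsProjFamily N₀) (t : ℝ) : IsDiagonal N₀ ε (ampIndex N₀ t) :=
  ⟨fun s => hN.amp.commute s t, fun i => (ampIndex_mul_blockProj ε t i).symm⟩

lemma isDiagonal_blockProj (i : ℕ) : IsDiagonal N₀ ε (blockProj ε i) := by
  refine ⟨fun t => ampIndex_mul_blockProj ε t i, fun j => ?_⟩
  rcases eq_or_ne i j with rfl | h
  · rfl
  · rw [blockProj_mul_of_ne ε h, blockProj_mul_of_ne ε h.symm]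

variable (ε) in
/-- `T(S, R, C)` as a subalgebra. -/
def TSRC.subalgebra (hnest : IsNest 𝒩₀) (hN₀ : IsSpectralIndexing 𝒩₀ N₀)
    {S : ℕ → ℕ → Set ℝ} {R C : ℕ → Set ℝ} (hSRC : IsExtendedTriangularSystem S R C) :
    Subalgebra ℂ (HilbertTensor H K →L[ℂ] HilbertTensor H K) where
  carrier := TSRC 𝒩₀ N₀ ε S R C
  mul_mem' hX hY := mul_mem_TSRC ε hnest hN₀ hSRC hX hY
  add_mem' hX hY := add_mem_TSRC ε hnest hN₀ hX hY
  algebraMap_mem' c := (IsDiagonal.algebraMap c).mem_TSRC hnest hN₀ hSRC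

end Diagonal

end TriangularAlgebras

end

open TriangularAlgebras in
theorem mainTheorem2
    {H K : Type*}
    [NormedAddCommGroup H] [InnerProductSpace ℂ H] [CompleteSpace H]
    [NormedAddCommGroup K] [InnerProductSpace ℂ K] [CompleteSpace K]
    -- a multiplicity-free continuous nest on `H`, indexed compatibly with its spectral measure
    (𝒩₀ : Set (H →L[ℂ] H)) (hnest : IsNest 𝒩₀) (hcont : IsContinuousNest 𝒩₀)
    (hmult : IsMultiplicityFree 𝒩₀)
    (N₀ : ℝ → H →L[ℂ] H) (hN₀ : IsSpectralIndexing 𝒩₀ N₀)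
    -- an atomic masa on `K`, and an orthonormal basis of `K` consisting of vectors in its atoms
    (D₀ : StarSubalgebra ℂ (K →L[ℂ] K)) (hD₀ : IsAtomicMasa D₀)
    (ε : HilbertBasis ℕ ℂ K) (hε : ∀ i, ∃ P, IsAtomOf D₀ P ∧ P (ε i) = ε i)
    (S : ℕ → ℕ → Set ℝ) (R C : ℕ → Set ℝ) (hSRC : IsExtendedTriangularSystem S R C) :
    IsTriangularAlgebra (TSRC 𝒩₀ N₀ ε S R C) ∧
    {X | X ∈ TSRC 𝒩₀ N₀ ε S R C ∧ star X ∈ TSRC 𝒩₀ N₀ ε S R C} =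
      vnTensor (Set.centralizer 𝒩₀) (D₀ : Set (K →L[ℂ] K)) := by
  have hN := hN₀.isProjFamily hnest
  have hchain : ∀ P ∈ 𝒩₀, ∀ Q ∈ 𝒩₀, P * Q = Q * P := by
    intro P hP Q hQ
    rw [hN₀.2] at hP hQ
    obtain ⟨s, -, rfl⟩ := hP
    obtain ⟨t, -, rfl⟩ := hQ
    exact hN.commute s t
  obtain ⟨ξ, hξ, -⟩ := hmult
  have hcomm : ∀ A ∈ Set.centralizer 𝒩₀, ∀ B ∈ Set.centralizer 𝒩₀, A * B = B * A :=
    fun A hA B hB => centralizer_commute_of_cyclic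
      (fun P hP => by rwa [(hnest.isStarProjection P hP).isSelfAdjoint.star_eq]) hchain hξ hA hB
  have hrank : ∀ i, InnerProductSpace.rankOne ℂ (ε i) (ε i) ∈ D₀ := fun i => by
    obtain ⟨P, hP, hPε⟩ := hε i
    exact hD₀.isMasa.rankOne_mem hP (ε.orthonormal.1 i) hPε
  have hdiag := fun X => mem_TSRC_and_star_mem_iff (X := X) (ε := ε) hnest hN₀ hSRC
  refine ⟨⟨TSRC.subalgebra ε hnest hN₀ hSRC, rfl, ?_, ?_⟩, ?_⟩
  · exact fun X hX Y hY => ((hdiag X).mp hX).commute hN₀ hcomm ((hdiag Y).mp hY)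
  -- A commutative algebra above the diagonal contains every `N_t` and `E_i`, so each of its
  -- elements commutes with them and is diagonal.
  · intro B hB hle X hX
    refine (hdiag X).mpr ⟨fun t => hB _ (hle ?_) X hX, fun i => hB _ (hle ?_) X hX⟩
    · exact (hdiag _).mpr (isDiagonal_ampIndex hN t)
    · exact (hdiag _).mpr (isDiagonal_blockProj i)
  · ext X
    exact (hdiag X).trans (isDiagonal_iff_mem_vnTensor hnest hN₀ hD₀.isMasa hrank)
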